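/- Consider a Markov decision process with finite state space $\mathcal S$, finite action space $\mathcal A$, initial distribution $p_0$, transition probabilities $p(s'\mid s,a)$, reward function $r:\mathcal S\times\mathcal A\to\mathbb R$ and discount factor $\gamma\in[0,1)$. Let $\pi$ (target) and $\mu$ (behavior) be policies, and let $S_0\sim p_0$, $A_t\sim\mu(\cdot\mid S_t)$, $R_{t+1}=r(S_t,A_t)$, $S_{t+1}\sim p(\cdot\mid S_t,A_t)$ be the Markovian data stream generated by $\mu$. Write $\rho(s,a)=\pi(a\mid s)/\mu(a\mid s)$, $P_\pi(s,s')=\sum_a\pi(a\mid s)p(s'\mid s,a)$, $r_\pi(s)=\sum_a\pi(a\mid s)r(s,a)$ (and $P_\mu$ likewise); let $x:\mathcal S\to\mathbb R^K$ be a feature map, $X\in\mathbb R^{|\mathcal S|\times K}$ the matrix with rows $x(s)^\top$, $d_\mu$ the stationary distribution of the chain with transition matrix $P_\mu$, $D_\mu=\mathrm{diag}(d_\mu)$, and $$A=X^\top D_\mu(\gamma P_\pi-I)X,\qquad b=X^\top D_\mu r_\pi .$$ Assume: 1. The state chain with transition matrix $P_\mu$ is irreducible and aperiodic, and $\mu$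 covers $\pi$: $\pi(a\mid s)>0$ implies $\mu(a\mid s)>0$ for all $(s,a)$. 2. $X$ has full column rank and $A$ is nonsingular. 3. $\alpha_t=C_\alpha/(t+1)^\nu$ for all $t\ge 0$, with $C_\alpha>0$ and $\nu\in(\tfrac23,1]$. 4. $f:\mathbb N\to\mathbb N$ is increasing (not necessarily strictly), $\sum_{t=0}^\infty\chi^{f(t)}<\infty$ for every $\chi\in[0,1)$, and there are constants $\tau\in\bigl(0,\tfrac{3\nu-2}{2\nu}\bigr)$ and $C_\tau>0$ with $f(t)\le C_\tau\alpha_t^{-\tau}$ for all $t$. With $x_t=x(S_t)$ and $\rho_t=\rho(S_t,A_t)$, and for an arbitrary (possibly random) initial vector $w_0\in\mathbb R^K$, define $$\delta_t=R_{t+1}+\gamma x_{t+1}^\top w_t-x_t^\top w_t,\qquad w_{t+1}=w_t+\alpha_t\,\rho_{t+f(t)}\bigl(x_{t+f(t)}-\gamma x_{t+f(t)+1}\bigr)x_{t+f(t)}^\top\,\rho_t\,\delta_t\,x_t .$$ Then $\lim_{t\to\infty}w_t=w_*$ almost surely, where $w_*=-A^{-1}b$ is the TD fixed point, i.e. the solution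 of $Aw_*+b=0$. -/

import Mathlib

open MeasureTheory Filter Topology Matrix

namespace OffPolicyTD

/-- A finite discounted Markov decision process with state space `S` and action space `Act`. -/
structure FiniteMDP (S Act : Type*) [Fintype S] where
  /-- initial state distribution -/
  p₀ : S → ℝ
  /-- `p s a s'` is the probability of moving to `s'` after taking action `a` in state `s` -/
  p : S → Act → S → ℝ
  /-- reward function -/
  r : S → Act → ℝ
  /-- discount factor -/
  γ : ℝ
  p₀_nonneg : ∀ s, 0 ≤ p₀ s
  p₀_sum : ∑ s, p₀ s = 1
  p_nonneg : ∀ s a s', 0 ≤ p s a s'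
  p_sum : ∀ s a, ∑ s', p s a s' = 1
  γ_nonneg : 0 ≤ γ
  γ_lt_one : γ < 1

/-- A stochastic stationary policy: `prob s a` is the probability of choosing `a` in `s`. -/
structure Policy (S Act : Type*) [Fintype Act] where
  prob : S → Act → ℝ
  prob_nonneg : ∀ s a, 0 ≤ prob s a
  prob_sum : ∀ s, ∑ a, prob s a = 1

variable {S Act : Type*} [Fintype S] [Fintype Act]

/-- The state transition matrix induced by a policy. -/
noncomputable def FiniteMDP.transition (M : FiniteMDP S Act) (π : Policy S Act) :
    Matrix S S ℝ :=
  Matrix.of fun s s' => ∑ a, π.prob s a * M.p s a s'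

/-- The reward vector induced by a policy. -/
noncomputable def FiniteMDP.rewardVec (M : FiniteMDP S Act) (π : Policy S Act) : S → ℝ :=
  fun s => ∑ a, π.prob s a * M.r s a

/-- Every state has period one: the only common divisor of its possible return times is `1`. -/
def IsAperiodic [DecidableEq S] (P : Matrix S S ℝ) : Prop :=
  ∀ s : S, ∀ d : ℕ, (∀ n : ℕ, 1 ≤ n → 0 < (P ^ n) s s → d ∣ n) → d = 1

/-- `d` is a stationary probability distribution of the transition matrix `P`. -/
def IsStationaryDist (P : Matrix S S ℝ) (d : S → ℝ) : Prop :=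
  (∀ s, 0 ≤ d s) ∧ ∑ s, d s = 1 ∧ d ᵥ* P = d

theorem exists_isStationaryDist [Nonempty S] (P : Matrix S S ℝ) (h0 : ∀ s s', 0 ≤ P s s')
    (h1 : ∀ s, ∑ s', P s s' = 1) : ∃ d, IsStationaryDist P d := by
  classical
  have hdet : (P - 1).det = 0 := by
    rw [← Matrix.exists_mulVec_eq_zero_iff]
    refine ⟨fun _ => 1, ?_, ?_⟩
    · intro h
      have := congrFun h (Classical.arbitrary S)
      simp at this
    · ext s
      have := h1 s
      simp [Matrix.mulVec, dotProduct, Matrix.one_apply, this]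
  obtain ⟨v, hv, hvP⟩ := Matrix.exists_vecMul_eq_zero_iff.mpr hdet
  have hfix : ∀ s, ∑ i, v i * P i s = v s := by
    intro s
    have := congrFun hvP s
    rw [Matrix.vecMul_sub, Matrix.vecMul_one] at this
    simp only [Pi.sub_apply, Pi.zero_apply, Matrix.vecMul, dotProduct] at this
    linarith
  have hle : ∀ s, |v s| ≤ ∑ i, |v i| * P i s := by
    intro s
    rw [← hfix s]
    refine (Finset.abs_sum_le_sum_abs _ _).trans (le_of_eq ?_)
    exact Finset.sum_congr rfl fun i _ => by rw [abs_mul, abs_of_nonneg (h0 i s)]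
  have hsum : ∑ s, |v s| = ∑ s, ∑ i, |v i| * P i s := by
    rw [Finset.sum_comm]
    exact Finset.sum_congr rfl fun i _ => by rw [← Finset.mul_sum, h1, mul_one]
  have heq := (Finset.sum_eq_sum_iff_of_le fun s _ => hle s).mp hsum
  have hpos : 0 < ∑ s, |v s| := by
    obtain ⟨s, hs⟩ := Function.ne_iff.mp hv
    exact Finset.sum_pos' (fun i _ => abs_nonneg _) ⟨s, Finset.mem_univ s, abs_pos.mpr hs⟩
  refine ⟨fun s => |v s| / ∑ i, |v i|, fun s => by positivity, ?_, ?_⟩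
  · rw [← Finset.sum_div, div_self hpos.ne']
  · ext s
    rw [heq s (Finset.mem_univ s)]
    simp only [Matrix.vecMul, dotProduct]
    rw [Finset.sum_div]
    exact Finset.sum_congr rfl fun i _ => by ring

theorem FiniteMDP.exists_stationary (M : FiniteMDP S Act) (μ : Policy S Act) :
    ∃ d, IsStationaryDist (M.transition μ) d := by
  have hS : Nonempty S := by
    by_contra h
    rw [not_nonempty_iff] at h
    have := M.p₀_sum
    simp at this
  refine exists_isStationaryDist _ (fun s s' => ?_) (fun s => ?_)
  · exact Finset.sum_nonneg fun a _ => mul_nonneg (μ.prob_nonneg s a) (M.p_nonneg s a s')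
  · simp only [FiniteMDP.transition, Matrix.of_apply]
    rw [Finset.sum_comm]
    simp [← Finset.mul_sum, M.p_sum, μ.prob_sum]

/-- The stationary distribution of the state chain induced by the policy `μ`
(it is unique as soon as that chain is irreducible). -/
noncomputable def FiniteMDP.stationaryDist (M : FiniteMDP S Act) (μ : Policy S Act) : S → ℝ :=
  Classical.choose (M.exists_stationary μ)

theorem FiniteMDP.stationaryDist_spec (M : FiniteMDP S Act) (μ : Policy S Act) :
    IsStationaryDist (M.transition μ) (M.stationaryDist μ) :=
  Classical.choose_spec (M.exists_stationary μ)

/-- The importance sampling ratio of target policy `π` and behavior policy `μ`. -/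
noncomputable def ratio (π μ : Policy S Act) (s : S) (a : Act) : ℝ :=
  π.prob s a / μ.prob s a

/-- `μ` covers `π`. -/
def Covers (μ π : Policy S Act) : Prop :=
  ∀ s a, 0 < π.prob s a → 0 < μ.prob s a

variable {K : ℕ}

/-- The feature matrix, whose `s`-th row is the feature vector `x s`. -/
def featureMatrix (x : S → Fin K → ℝ) : Matrix S (Fin K) ℝ := Matrix.of x

/-- The matrix `Xᵀ D_μ (γ P_π - I) X`. -/
noncomputable def FiniteMDP.tdMatrix [DecidableEq S] (M : FiniteMDP S Act)
    (π μ : Policy S Act) (x : S → Fin K → ℝ) : Matrix (Fin K) (Fin K) ℝ :=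
  (featureMatrix x)ᵀ * Matrix.diagonal (M.stationaryDist μ) *
    (M.γ • M.transition π - 1) * featureMatrix x

/-- The vector `Xᵀ D_μ r_π`. -/
noncomputable def FiniteMDP.tdVector [DecidableEq S] (M : FiniteMDP S Act)
    (π μ : Policy S Act) (x : S → Fin K → ℝ) : Fin K → ℝ :=
  ((featureMatrix x)ᵀ * Matrix.diagonal (M.stationaryDist μ)) *ᵥ M.rewardVec π

/-- The TD fixed point `w_* = -A⁻¹ b` (for nonsingular `A`). -/
noncomputable def FiniteMDP.tdFixedPoint [DecidableEq S] (M : FiniteMDP S Act)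
    (π μ : Policy S Act) (x : S → Fin K → ℝ) : Fin K → ℝ :=
  -((M.tdMatrix π μ x)⁻¹ *ᵥ M.tdVector π μ x)

/-- The processes `St` and `At` are the states and actions obtained by following the policy `μ`
in the MDP: `S₀ ∼ p₀`, `A_t ∼ μ(· | S_t)`, `S_{t+1} ∼ p(· | S_t, A_t)`. -/
structure FiniteMDP.IsTrajectory (M : FiniteMDP S Act) (μ : Policy S Act)
    {Ω : Type*} [MeasurableSpace Ω] (ℙ : Measure Ω) (St : ℕ → Ω → S) (At : ℕ → Ω → Act) :
    Prop where
  measurable_state : ∀ t s, MeasurableSet {ω | St t ω = s}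
  measurable_action : ∀ t a, MeasurableSet {ω | At t ω = a}
  law : ∀ (n : ℕ) (s : ℕ → S) (a : ℕ → Act),
    ℙ.real {ω | ∀ i ≤ n, St i ω = s i ∧ At i ω = a i} =
      M.p₀ (s 0) * μ.prob (s 0) (a 0) *
        ∏ i ∈ Finset.range n, M.p (s i) (a i) (s (i + 1)) * μ.prob (s (i + 1)) (a (i + 1))

/-- The temporal difference error of the weight `w` on the transition `(s, a, s')`. -/
noncomputable def FiniteMDP.tdError (M : FiniteMDP S Act) (x : S → Fin K → ℝ)
    (w : Fin K → ℝ) (s : S) (a : Act) (s' : S) : ℝ :=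
  M.r s a + M.γ * (x s' ⬝ᵥ w) - x s ⬝ᵥ w

/-- The iterates of the algorithm with step sizes `α` and gap function `f`, run from the initial
weight `w₀` along the state sequence `s` and the action sequence `a`:
`w_{t+1} = w_t + α_t ρ_{t+f(t)} (x_{t+f(t)} - γ x_{t+f(t)+1}) x_{t+f(t)}ᵀ ρ_t δ_t x_t`. -/
noncomputable def FiniteMDP.iterates (M : FiniteMDP S Act) (π μ : Policy S Act)
    (x : S → Fin K → ℝ) (α : ℕ → ℝ) (f : ℕ → ℕ) (w₀ : Fin K → ℝ)
    (s : ℕ → S) (a : ℕ → Act) : ℕ → Fin K → ℝ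
  | 0 => w₀
  | t + 1 =>
    let w := M.iterates π μ x α f w₀ s a t
    let u := t + f t
    w + α t • (ratio π μ (s u) (a u) •
      (Matrix.vecMulVec (x (s u) - M.γ • x (s (u + 1))) (x (s u)) *ᵥ
        ((ratio π μ (s t) (a t) * M.tdError x w (s t) (a t) (s (t + 1))) • x (s t))))

/-- The step sizes `α_t = C_α / (t+1)^ν`. -/
noncomputable def stepSize (Cα ν : ℝ) (t : ℕ) : ℝ := Cα / ((t : ℝ) + 1) ^ ν

end OffPolicyTD

/-! Let `Â(y) = ρ(s,a) x(s) (γ x(s') - x(s))ᵀ` and `b̂(y) = ρ(s,a) r(s,a) x(s)` for a transition `y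
= (s,a,s')`. The algorithm is the linear recursion `w ↦ w - α_t Â(Y_{t+f(t)})ᵀ (Â(Y_t) w +
b̂(Y_t))`. Importance weighting gives `Â` and `b̂` the stationary means `A` and `b`, and the growing
gap makes the two samples asymptotically independent, so the mean dynamics is `w ↦ -Aᵀ(A w + b)`:
gradient descent on `½‖A w + b‖²`, which contracts towards `w_*` because `A` is invertible.

The argument separates path from probability. If the weighted fluctuations of the coefficients form
convergent series along a path, their tails give a change of variables that removes the noise, and
the iterates converge on that path; no prior bound on them is needed
(`tendsto_zero_of_linear_recursion`, `tendsto_of_matrix_recursion`).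

Almost sure convergence of these series is a second moment estimate. A fluctuation `g(Y_{t+f(t)})
h(Y_t) - m(g) m(h)` splits into a prediction error, uncorrelated beyond lag `f`; a centered
observable with geometrically decaying covariances; and a bias of order `χ^{f(t)}`, which is
summable (`ae_exists_tendsto_sum_product`). The first two have total correlations `O((s+1)^κ)` with
`κ < 3ν - 2`, and summing over polynomially growing blocks then gives convergence
(`ae_exists_tendsto_sum_stepSize`). Mixing comes from `geometric_ergodicity` of the state chain. -/

set_option linter.unusedSectionVars false

/-! ### Deterministic recursions with contractive mean dynamics -/

namespace OffPolicyTD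

/-- A nonnegative sequence contracted by `1 - a t` up to an error `a t * ε t` with `ε → 0`
vanishes if the gains `a t` have infinite sum. -/
theorem tendsto_zero_of_contraction {u a ε : ℕ → ℝ} {T : ℕ} (hu : ∀ t, 0 ≤ u t)
    (ha : ∀ t, 0 ≤ a t) (ha1 : ∀ t ≥ T, a t ≤ 1)
    (hsum : Tendsto (fun n => ∑ t ∈ Finset.range n, a t) atTop atTop)
    (hε : Tendsto ε atTop (𝓝 0))
    (hrec : ∀ t ≥ T, u (t + 1) ≤ (1 - a t) * u t + a t * ε t) :
    Tendsto u atTop (𝓝 0) := by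
  have key : ∀ δ > 0, ∀ᶠ t in atTop, u t < 2 * δ := by
    intro δ hδ
    obtain ⟨N, hN⟩ := eventually_atTop.1 (hε.eventually (gt_mem_nhds hδ))
    set T' := max T N with hT'
    -- The excess over `δ` shrinks by `1 - a t ≤ exp (-a t)` at each step. The absolute value keeps
    -- the bound nonnegative even when the excess is not.
    have hbd : ∀ n, u (T' + n) - δ ≤
        |u T' - δ| * Real.exp (-(∑ t ∈ Finset.range (T' + n), a t - ∑ t ∈ Finset.range T', a t)) := by
      intro n
      induction n with
      | zero => simpa using le_abs_self (u T' - δ)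
      | succ n ih =>
        have h1 := hrec (T' + n) (by omega)
        have h2 := hN (T' + n) (by omega)
        have h3 := ha1 (T' + n) (by omega)
        have h4 := ha (T' + n)
        rw [← add_assoc, Finset.sum_range_succ]
        have h5 : u (T' + n + 1) - δ ≤ (1 - a (T' + n)) * (u (T' + n) - δ) := by
          nlinarith [mul_le_mul_of_nonneg_left h2.le h4]
        have h6 : 1 - a (T' + n) ≤ Real.exp (-a (T' + n)) := Real.one_sub_le_exp_neg _
        set E := |u T' - δ| *
          Real.exp (-(∑ t ∈ Finset.range (T' + n), a t - ∑ t ∈ Finset.range T', a t)) with hE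
        have hE0 : 0 ≤ E := by positivity
        calc _ ≤ _ := h5
          _ ≤ (1 - a (T' + n)) * E := mul_le_mul_of_nonneg_left ih (by linarith)
          _ ≤ Real.exp (-a (T' + n)) * E := mul_le_mul_of_nonneg_right h6 hE0
          _ = _ := by
            rw [hE, mul_left_comm, ← Real.exp_add]
            congr 2
            ring
    have hlim : Tendsto (fun n => |u T' - δ| *
        Real.exp (-(∑ t ∈ Finset.range n, a t - ∑ t ∈ Finset.range T', a t))) atTop (𝓝 0) := by
      rw [← mul_zero |u T' - δ|]
      refine Tendsto.const_mul _ (Real.tendsto_exp_neg_atTop_nhds_zero.comp ?_)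
      exact tendsto_atTop_add_const_right atTop (-(∑ t ∈ Finset.range T', a t)) hsum
    filter_upwards [hlim.eventually (gt_mem_nhds hδ), eventually_ge_atTop T'] with t ht htT
    obtain ⟨n, rfl⟩ := Nat.exists_eq_add_of_le htT
    linarith [hbd n]
  rw [Metric.tendsto_atTop]
  intro δ hδ
  obtain ⟨N, hN⟩ := eventually_atTop.1 (key (δ / 2) (by positivity))
  refine ⟨N, fun n hn => ?_⟩
  rw [Real.dist_eq, sub_zero, abs_of_nonneg (hu n)]
  linarith [hN n hn]

/-- A linear recursion with bounded coefficients converges to zero along any path on which the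
weighted fluctuations of the coefficients form convergent series, provided that the mean dynamics
is contractive. -/
theorem tendsto_zero_of_linear_recursion {E : Type*} [NormedAddCommGroup E] [NormedSpace ℝ E]
    {α : ℕ → ℝ} (hα : ∀ t, 0 ≤ α t) (hα0 : Tendsto α atTop (𝓝 0))
    (hαs : Tendsto (fun n => ∑ t ∈ Finset.range n, α t) atTop atTop)
    {B : ℕ → E →L[ℝ] E} {b : ℕ → E} {Bm : E →L[ℝ] E} {MB Mb c : ℝ}
    (hB : ∀ t, ‖B t‖ ≤ MB) (hb : ∀ t, ‖b t‖ ≤ Mb) (hc : 0 < c)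
    (hcontr : ∀ᶠ t in atTop, ∀ v, ‖v + α t • Bm v‖ ≤ (1 - c * α t) * ‖v‖)
    {LB : E →L[ℝ] E} {Lb : E}
    (hLB : Tendsto (fun n => ∑ t ∈ Finset.range n, α t • (B t - Bm)) atTop (𝓝 LB))
    (hLb : Tendsto (fun n => ∑ t ∈ Finset.range n, α t • b t) atTop (𝓝 Lb))
    {e : ℕ → E} (he : ∀ t, e (t + 1) = e t + α t • (B t (e t) + b t)) :
    Tendsto e atTop (𝓝 0) := by
  set Z : ℕ → E →L[ℝ] E := fun n => LB - ∑ t ∈ Finset.range n, α t • (B t - Bm) with hZ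
  set y : ℕ → E := fun n => Lb - ∑ t ∈ Finset.range n, α t • b t with hy
  have hZ0 : Tendsto (fun n => ‖Z n‖) atTop (𝓝 0) := by
    have := (tendsto_const_nhds (x := LB)).sub hLB
    rw [sub_self] at this
    exact tendsto_zero_iff_norm_tendsto_zero.1 this
  have hy0 : Tendsto (fun n => ‖y n‖) atTop (𝓝 0) := by
    have := (tendsto_const_nhds (x := Lb)).sub hLb
    rw [sub_self] at this
    exact tendsto_zero_iff_norm_tendsto_zero.1 this
  have hZs : ∀ n, Z (n + 1) = Z n - α n • (B n - Bm) := fun n => by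
    simp only [hZ, Finset.sum_range_succ]; abel
  have hys : ∀ n, y (n + 1) = y n - α n • b n := fun n => by
    simp only [hy, Finset.sum_range_succ]; abel
  -- The increments of the tails `Z` and `y` cancel the noise in `e`, so `v` follows the mean
  -- dynamics up to the remainder `α n • r n`, in which every term carries a vanishing factor `Z` or
  -- `y`.
  set v : ℕ → E := fun n => e n + Z n (e n) + y n with hv
  set r : ℕ → E := fun n => Z (n + 1) (B n (e n) + b n) - Bm (Z n (e n) + y n) with hr
  have hvrec : ∀ n, v (n + 1) = (v n + α n • Bm (v n)) + α n • r n := by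
    intro n
    simp only [hv, hr, hys, he]
    simp only [map_add, map_smul, hZs n, _root_.sub_apply,
      _root_.smul_apply]
    simp only [smul_add, smul_sub]
    abel
  have hMB : 0 ≤ MB := (norm_nonneg _).trans (hB 0)
  have hMb : 0 ≤ Mb := (norm_nonneg _).trans (hb 0)
  have he_le : ∀ n, ‖Z n‖ ≤ 1 / 2 → ‖e n‖ ≤ 2 * (‖v n‖ + ‖y n‖) := by
    intro n hn
    have h1 : e n = v n - Z n (e n) - y n := by simp only [hv]; abel
    have h2 : ‖e n‖ ≤ ‖v n‖ + ‖Z n (e n)‖ + ‖y n‖ := by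
      calc ‖e n‖ = ‖v n - Z n (e n) - y n‖ := by rw [← h1]
        _ ≤ ‖v n - Z n (e n)‖ + ‖y n‖ := norm_sub_le _ _
        _ ≤ _ := by gcongr; exact norm_sub_le _ _
    have h3 : ‖Z n (e n)‖ ≤ 1 / 2 * ‖e n‖ :=
      (Z n).le_of_opNorm_le hn _
    linarith
  set ε : ℕ → ℝ := fun n => ‖Z (n + 1)‖ * (MB * 2 + MB * 2 * ‖y n‖ + Mb) +
    ‖Bm‖ * (2 * ‖Z n‖ + 2 * ‖Z n‖ * ‖y n‖ + ‖y n‖) with hε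
  have hε0 : Tendsto ε atTop (𝓝 0) := by
    have hZ1 := (tendsto_add_atTop_iff_nat 1).2 hZ0
    have h1 := hZ1.mul (((hy0.const_mul (MB * 2)).const_add (MB * 2)).add_const Mb)
    have h2 := (((hZ0.const_mul 2).add ((hZ0.const_mul 2).mul hy0)).add hy0).const_mul ‖Bm‖
    simpa using h1.add h2
  -- Linear growth in `‖v n‖` is harmless: once `ε n < c / 2`, half of the contraction rate `c`
  -- absorbs it. Hence boundedness of `e` is not needed beforehand.
  have hr_le : ∀ n, ‖Z n‖ ≤ 1 / 2 → ‖r n‖ ≤ ε n * (‖v n‖ + 1) := by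
    intro n hn
    have hen := he_le n hn
    have hv0 := norm_nonneg (v n)
    have hy0 := norm_nonneg (y n)
    have h1 : ‖Z (n + 1) (B n (e n) + b n)‖ ≤ ‖Z (n + 1)‖ * (MB * (2 * (‖v n‖ + ‖y n‖)) + Mb) := by
      refine (Z (n + 1)).le_of_opNorm_le_of_le le_rfl ((norm_add_le _ _).trans ?_)
      exact add_le_add ((B n).le_of_opNorm_le_of_le (hB n) hen) (hb n)
    have h2 : ‖Bm (Z n (e n) + y n)‖ ≤ ‖Bm‖ * (‖Z n‖ * (2 * (‖v n‖ + ‖y n‖)) + ‖y n‖) := by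
      refine Bm.le_of_opNorm_le_of_le le_rfl ((norm_add_le _ _).trans ?_)
      exact add_le_add_left ((Z n).le_of_opNorm_le_of_le le_rfl hen) _
    refine (norm_sub_le _ _).trans ((add_le_add h1 h2).trans ?_)
    rw [hε, add_mul]
    refine add_le_add ?_ ?_
    · rw [mul_assoc]
      refine mul_le_mul_of_nonneg_left ?_ (norm_nonneg _)
      nlinarith [mul_nonneg (mul_nonneg hMB hy0) hv0, mul_nonneg hMb hv0]
    · rw [mul_assoc]
      refine mul_le_mul_of_nonneg_left ?_ (norm_nonneg _)
      nlinarith [mul_nonneg (mul_nonneg (norm_nonneg (Z n)) hy0) hv0, mul_nonneg hy0 hv0,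
        norm_nonneg (Z n)]
  have hv0 : Tendsto (fun n => ‖v n‖) atTop (𝓝 0) := by
    have hev : ∀ᶠ n in atTop, ‖Z n‖ < 1 / 2 ∧ ε n < c / 2 ∧ α n < 2 / c ∧
        ∀ v, ‖v + α n • Bm v‖ ≤ (1 - c * α n) * ‖v‖ := by
      filter_upwards [hZ0.eventually (gt_mem_nhds (by norm_num : (0 : ℝ) < 1 / 2)),
        hε0.eventually (gt_mem_nhds (by positivity : (0 : ℝ) < c / 2)),
        hα0.eventually (gt_mem_nhds (by positivity : (0 : ℝ) < 2 / c)), hcontr]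
        with n h1 h2 h3 h4 using ⟨h1, h2, h3, h4⟩
    obtain ⟨T, hT⟩ := eventually_atTop.1 hev
    have hsum' : Tendsto (fun n => ∑ t ∈ Finset.range n, c / 2 * α t) atTop atTop := by
      simp_rw [← Finset.mul_sum]
      exact hαs.const_mul_atTop (by positivity)
    have hε' : Tendsto (fun n => 2 / c * ε n) atTop (𝓝 0) := by simpa using hε0.const_mul (2 / c)
    refine tendsto_zero_of_contraction (T := T) (fun _ => norm_nonneg _)
      (fun t => mul_nonneg (by positivity) (hα t)) (fun t ht => ?_) hsum' hε' (fun t ht => ?_)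
    · have := (hT t ht).2.2.1
      rw [lt_div_iff₀ hc] at this
      linarith
    · obtain ⟨h1, h2, h3, h4⟩ := hT t ht
      have hnn := norm_nonneg (v t)
      have hr' := hr_le t h1.le
      have h6 : c / 2 * α t * (2 / c * ε t) = α t * ε t := by field_simp
      rw [h6]
      calc ‖v (t + 1)‖ ≤ ‖v t + α t • Bm (v t)‖ + ‖α t • r t‖ := by
            rw [hvrec]; exact norm_add_le _ _
        _ ≤ (1 - c * α t) * ‖v t‖ + α t * (ε t * (‖v t‖ + 1)) := by
            rw [norm_smul, Real.norm_of_nonneg (hα t)]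
            exact add_le_add (h4 _) (mul_le_mul_of_nonneg_left hr' (hα t))
        _ ≤ _ := by
            nlinarith [mul_le_mul_of_nonneg_right h2.le (mul_nonneg (hα t) hnn)]
  rw [tendsto_zero_iff_norm_tendsto_zero]
  have hlim : Tendsto (fun n => 2 * (‖v n‖ + ‖y n‖)) atTop (𝓝 0) := by
    simpa using (hv0.add hy0).const_mul 2
  refine squeeze_zero' (Eventually.of_forall fun _ => norm_nonneg _) ?_ hlim
  filter_upwards [hZ0.eventually (gt_mem_nhds (by norm_num : (0 : ℝ) < 1 / 2))] with n hn
  exact he_le n hn.le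

/-- The negative Gram operator of an operator that is bounded below is contractive for small
gains. -/
theorem exists_contraction_of_neg_gram {E : Type*} [NormedAddCommGroup E] [InnerProductSpace ℝ E]
    [CompleteSpace E] (A : E →L[ℝ] E) {m : ℝ} (hm : 0 < m) (hA : ∀ v, m * ‖v‖ ^ 2 ≤ ‖A v‖ ^ 2)
    {α : ℕ → ℝ} (hα : ∀ t, 0 ≤ α t) (hα0 : Tendsto α atTop (𝓝 0)) :
    ∀ᶠ t in atTop, ∀ v, ‖v + α t • (-(ContinuousLinearMap.adjoint A ∘L A)) v‖ ≤
      (1 - m / 2 * α t) * ‖v‖ := by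
  set G := ContinuousLinearMap.adjoint A ∘L A with hG
  -- In `‖v - α G v‖² = ‖v‖² - 2α‖A v‖² + α²‖G v‖²`, a gain below this threshold makes the last term
  -- at most `α m ‖v‖²`, leaving `1 - α m ≤ (1 - α m / 2)²`. The threshold `1 / m` makes the base of
  -- this square nonnegative.
  have hpos : 0 < m / (‖G‖ ^ 2 + 1) := by positivity
  filter_upwards [hα0.eventually (gt_mem_nhds hpos),
    hα0.eventually (gt_mem_nhds (by positivity : 0 < 1 / m))] with t ht ht' v
  rw [lt_div_iff₀ hm] at ht'
  rw [lt_div_iff₀ (by positivity)] at ht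
  have h0 := hα t
  refine le_of_sq_le_sq ?_ (mul_nonneg (by nlinarith) (norm_nonneg _))
  have hin : inner ℝ v (G v) = ‖A v‖ ^ 2 := by
    rw [hG, ContinuousLinearMap.comp_apply, ContinuousLinearMap.adjoint_inner_right,
      real_inner_self_eq_norm_sq]
  have hGv : ‖G v‖ ^ 2 ≤ ‖G‖ ^ 2 * ‖v‖ ^ 2 := by
    rw [← mul_pow]
    gcongr
    exact G.le_opNorm v
  rw [_root_.neg_apply, smul_neg, ← sub_eq_add_neg, norm_sub_sq_real,
    inner_smul_right, hin, norm_smul, Real.norm_of_nonneg h0, mul_pow, mul_pow]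
  have h1 := mul_le_mul_of_nonneg_left (hA v) h0
  have h2 := mul_le_mul_of_nonneg_left hGv (sq_nonneg (α t))
  have h3 : α t ^ 2 * (‖G‖ ^ 2 * ‖v‖ ^ 2) ≤ α t * m * ‖v‖ ^ 2 := by
    have : α t * ‖G‖ ^ 2 ≤ m := by nlinarith
    have := mul_le_mul_of_nonneg_left this (mul_nonneg h0 (sq_nonneg ‖v‖))
    nlinarith
  nlinarith [sq_nonneg (m / 2 * α t * ‖v‖)]

end OffPolicyTD

/-! ### Geometric ergodicity of finite chains -/

namespace OffPolicyTD

variable {T : Type*} [Fintype T]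

theorem pow_nonneg_apply [DecidableEq T] {P : Matrix T T ℝ} (h0 : ∀ i j, 0 ≤ P i j) (n : ℕ) :
    ∀ i j, 0 ≤ (P ^ n) i j := by
  induction n with
  | zero => intro i j; rw [pow_zero, Matrix.one_apply]; split_ifs <;> norm_num
  | succ n ih =>
    intro i j
    rw [pow_succ, Matrix.mul_apply]
    exact Finset.sum_nonneg fun k _ => mul_nonneg (ih i k) (h0 k j)

theorem pow_row_sum [DecidableEq T] {P : Matrix T T ℝ} (h1 : ∀ i, ∑ j, P i j = 1) (n : ℕ) :
    ∀ i, ∑ j, (P ^ n) i j = 1 := by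
  induction n with
  | zero => intro i; simp [Matrix.one_apply]
  | succ n ih =>
    intro i
    simp_rw [pow_succ, Matrix.mul_apply]
    rw [Finset.sum_comm]
    simp_rw [← Finset.mul_sum, h1, mul_one]
    exact ih i

theorem pow_add_pos [DecidableEq T] {P : Matrix T T ℝ} (h0 : ∀ i j, 0 ≤ P i j) {m n : ℕ}
    {i j k : T} (hm : 0 < (P ^ m) i j) (hn : 0 < (P ^ n) j k) : 0 < (P ^ (m + n)) i k := by
  rw [pow_add, Matrix.mul_apply]
  exact Finset.sum_pos' (fun l _ => mul_nonneg (pow_nonneg_apply h0 m i l)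
    (pow_nonneg_apply h0 n l k)) ⟨j, Finset.mem_univ _, mul_pos hm hn⟩

/-- An irreducible aperiodic matrix is primitive. -/
theorem exists_pow_pos_of_irreducible_aperiodic [DecidableEq T] {P : Matrix T T ℝ}
    (hirr : P.IsIrreducible) (haper : IsAperiodic P) : ∃ N > 0, ∀ i j, 0 < (P ^ N) i j := by
  have h0 := hirr.nonneg
  have hpath := (Matrix.isIrreducible_iff_exists_pow_pos h0).1 hirr
  choose k hk0 hk using hpath
  -- Return times are closed under addition and have gcd one, so they contain all large integers.
  have hret : ∀ s, ∃ N, ∀ m ≥ N, 0 < (P ^ m) s s := by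
    intro s
    set R : Set ℕ := {n | 1 ≤ n ∧ 0 < (P ^ n) s s} with hR
    have hg : Nat.setGcd R = 1 :=
      haper s _ fun n hn hpos => Nat.setGcd_dvd_of_mem (s := R) ⟨hn, hpos⟩
    obtain ⟨N, hN⟩ := Nat.exists_mem_closure_of_ge R
    refine ⟨N, fun m hm => ?_⟩
    have hmem := hN m hm (hg ▸ one_dvd m)
    clear hm
    induction hmem using AddSubmonoid.closure_induction with
    | mem n hn => exact hn.2
    | zero => simp
    | add a b _ _ ha hb => exact pow_add_pos h0 ha hb
  choose N hN using hret
  -- One exponent serves all pairs: it leaves at least `N i` steps to loop at `i` before the path of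
  -- length `k i j` to `j`.
  refine ⟨∑ i, N i + ∑ i, ∑ j, k i j + 1, by omega, fun i j => ?_⟩
  have h1 : N i ≤ ∑ i, N i := Finset.single_le_sum (fun _ _ => Nat.zero_le _) (Finset.mem_univ i)
  have h2 : k i j ≤ ∑ i, ∑ j, k i j :=
    (Finset.single_le_sum (f := fun j => k i j) (fun _ _ => Nat.zero_le _)
      (Finset.mem_univ j)).trans
      (Finset.single_le_sum (f := fun i => ∑ j, k i j) (fun _ _ => Nat.zero_le _)
        (Finset.mem_univ i))
  have h3 : ∑ i, N i + ∑ i, ∑ j, k i j + 1 =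
      (∑ i, N i + ∑ i, ∑ j, k i j + 1 - k i j) + k i j := by omega
  rw [h3]
  exact pow_add_pos h0 (hN i _ (by omega)) (hk i j)

/-- A stochastic matrix with entries bounded below by `ε` contracts oscillations. -/
theorem osc_mulVec_le [Nonempty T] {P : Matrix T T ℝ} (h1 : ∀ i, ∑ j, P i j = 1) {ε : ℝ}
    (hε0 : 0 ≤ ε) (hε : ∀ i j, ε ≤ P i j) {u : T → ℝ} {D : ℝ} (hu : ∀ i j, u i - u j ≤ D) :
    ∀ i j, (P *ᵥ u) i - (P *ᵥ u) j ≤ (1 - ε) * D := by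
  intro i j
  obtain ⟨a, ha⟩ := Finite.exists_min u
  obtain ⟨b, hb⟩ := Finite.exists_max u
  have hε1 : ε ≤ 1 := by
    rw [← h1 a]
    exact (hε a a).trans (Finset.single_le_sum (fun k _ => hε0.trans (hε a k)) (Finset.mem_univ a))
  -- Row `i` puts mass at least `ε` on the minimiser `a`, which lowers its average; the average over
  -- row `j` is never below the minimum.
  have hup : (P *ᵥ u) i ≤ u b - ε * (u b - u a) := by
    have h : u b - (P *ᵥ u) i = ∑ k, P i k * (u b - u k) := by
      simp_rw [mul_sub, Finset.sum_sub_distrib, ← Finset.sum_mul, h1, one_mul]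
      rfl
    have h2 : P i a * (u b - u a) ≤ ∑ k, P i k * (u b - u k) :=
      Finset.single_le_sum (f := fun k => P i k * (u b - u k))
        (fun k _ => mul_nonneg (hε0.trans (hε i k)) (sub_nonneg.2 (hb k))) (Finset.mem_univ a)
    have h3 := mul_le_mul_of_nonneg_right (hε i a) (sub_nonneg.2 (hb a))
    linarith
  have hlo : u a ≤ (P *ᵥ u) j := by
    have h : (P *ᵥ u) j - u a = ∑ k, P j k * (u k - u a) := by
      simp_rw [mul_sub, Finset.sum_sub_distrib, ← Finset.sum_mul, h1, one_mul]
      rfl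
    have : 0 ≤ ∑ k, P j k * (u k - u a) := Finset.sum_nonneg fun k _ =>
      mul_nonneg (hε0.trans (hε j k)) (sub_nonneg.2 (ha k))
    linarith
  calc _ ≤ (1 - ε) * (u b - u a) := by linarith
    _ ≤ _ := mul_le_mul_of_nonneg_left (hu b a) (by linarith)

theorem dotProduct_pow_mulVec [DecidableEq T] {P : Matrix T T ℝ} {d : T → ℝ} (hd : d ᵥ* P = d)
    (n : ℕ) (u : T → ℝ) : d ⬝ᵥ (P ^ n *ᵥ u) = d ⬝ᵥ u := by
  induction n with
  | zero => simp
  | succ n ih =>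
    rw [pow_succ', ← Matrix.mulVec_mulVec, Matrix.dotProduct_mulVec, hd, ih]

/-- Geometric ergodicity of irreducible aperiodic finite chains. -/
theorem geometric_ergodicity [DecidableEq T] {P : Matrix T T ℝ}
    (hirr : P.IsIrreducible) (haper : IsAperiodic P) (h1 : ∀ i, ∑ j, P i j = 1) {d : T → ℝ}
    (hd : IsStationaryDist P d) :
    ∃ χ ∈ Set.Ioo (0 : ℝ) 1, ∃ C : ℝ, 0 ≤ C ∧ ∀ (u : T → ℝ) (D : ℝ), (∀ i, |u i| ≤ D) →
      ∀ n i, |(P ^ n *ᵥ u) i - d ⬝ᵥ u| ≤ C * D * χ ^ n := by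
  have hne : Nonempty T := by
    by_contra h
    rw [not_nonempty_iff] at h
    have := hd.2.1
    simp at this
  have h0 := hirr.nonneg
  obtain ⟨N, hN, hpos⟩ := exists_pow_pos_of_irreducible_aperiodic hirr haper
  obtain ⟨⟨i₀, j₀⟩, hmin⟩ := Finite.exists_min fun ij : T × T => (P ^ N) ij.1 ij.2
  -- Capping at `1 / 2` keeps `β = 1 - ε` positive, as needed to divide by it even when all entries
  -- of `P ^ N` equal one.
  set ε := min ((P ^ N) i₀ j₀) (1 / 2) with hεdef
  have hε0 : 0 < ε := lt_min (hpos _ _) (by norm_num)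
  have hεh : ε ≤ 1 / 2 := min_le_right _ _
  have hε : ∀ i j, ε ≤ (P ^ N) i j := fun i j => (min_le_left _ _).trans (hmin (i, j))
  set β := 1 - ε with hβ
  have hβ0 : 0 < β := by linarith
  have hβ1 : β < 1 := by linarith
  have hosc1 : ∀ (m : ℕ) (u : T → ℝ) (D : ℝ), (∀ i j, u i - u j ≤ D) →
      ∀ i j, (P ^ m *ᵥ u) i - (P ^ m *ᵥ u) j ≤ D := by
    intro m u D hu i j
    simpa using osc_mulVec_le (pow_row_sum h1 m) le_rfl (pow_nonneg_apply h0 m) hu i j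
  have hoscN : ∀ (q : ℕ) (u : T → ℝ) (D : ℝ), (∀ i j, u i - u j ≤ D) →
      ∀ i j, (P ^ (N * q) *ᵥ u) i - (P ^ (N * q) *ᵥ u) j ≤ β ^ q * D := by
    intro q u D hu
    induction q with
    | zero => simpa using hu
    | succ q ih =>
      intro i j
      rw [Nat.mul_succ, add_comm, pow_add, ← Matrix.mulVec_mulVec, pow_succ', mul_assoc]
      exact osc_mulVec_le (pow_row_sum h1 N) hε0.le hε ih i j
  set χ := β ^ (1 / (N : ℝ)) with hχ
  have hN' : (0 : ℝ) < N := by exact_mod_cast hN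
  have hχ0 : 0 < χ := Real.rpow_pos_of_pos hβ0 _
  have hχ1 : χ < 1 := Real.rpow_lt_one hβ0.le hβ1 (by positivity)
  have hχN : χ ^ N = β := by
    rw [hχ, ← Real.rpow_natCast, ← Real.rpow_mul hβ0.le, one_div_mul_cancel hN'.ne', Real.rpow_one]
  refine ⟨χ, ⟨hχ0, hχ1⟩, 2 / β, by positivity, fun u D hu n i => ?_⟩
  have hD : 0 ≤ D := (abs_nonneg _).trans (hu i)
  have hu2 : ∀ i j, u i - u j ≤ 2 * D := fun i j => by
    have := abs_le.1 (hu i); have := abs_le.1 (hu j); linarith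
  have hosc : ∀ i j, (P ^ n *ᵥ u) i - (P ^ n *ᵥ u) j ≤ 2 / β * D * χ ^ n := by
    intro i j
    have hdm := Nat.div_add_mod n N
    have h2 : (P ^ n *ᵥ u) i - (P ^ n *ᵥ u) j ≤ β ^ (n / N) * (2 * D) := by
      rw [← hdm, pow_add, ← Matrix.mulVec_mulVec, hdm]
      simpa using hoscN (n / N) _ _ (hosc1 (n % N) u _ hu2) i j
    -- `n < N * (n / N + 1)`; the extra factor `β` is the price of the incomplete last block of `N`
    -- steps.
    have h3 : β * β ^ (n / N) ≤ χ ^ n := by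
      rw [← hχN, ← pow_mul, ← pow_add]
      refine pow_le_pow_of_le_one hχ0.le hχ1.le ?_
      have := Nat.mod_lt n hN
      omega
    have h4 : β ^ (n / N) ≤ χ ^ n / β := by rw [le_div_iff₀ hβ0]; linarith
    calc _ ≤ _ := h2
      _ ≤ χ ^ n / β * (2 * D) := mul_le_mul_of_nonneg_right h4 (by positivity)
      _ = _ := by ring
  -- By stationarity the deviation from the mean is a `d`-average of oscillations.
  have hexp : (P ^ n *ᵥ u) i - d ⬝ᵥ u = ∑ j, d j * ((P ^ n *ᵥ u) i - (P ^ n *ᵥ u) j) := by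
    simp_rw [mul_sub, Finset.sum_sub_distrib, ← Finset.sum_mul, hd.2.1, one_mul]
    rw [← dotProduct_pow_mulVec hd.2.2 n u]
    rfl
  rw [hexp]
  calc _ ≤ ∑ j, |d j * ((P ^ n *ᵥ u) i - (P ^ n *ᵥ u) j)| := Finset.abs_sum_le_sum_abs _ _
    _ ≤ ∑ j, d j * (2 / β * D * χ ^ n) := by
        refine Finset.sum_le_sum fun j _ => ?_
        rw [abs_mul, abs_of_nonneg (hd.1 j)]
        refine mul_le_mul_of_nonneg_left (abs_le.2 ⟨?_, hosc i j⟩) (hd.1 j)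
        linarith [hosc j i]
    _ = _ := by rw [← Finset.sum_mul, hd.2.1, one_mul]

end OffPolicyTD

/-! ### The Markov property in integrated form -/

namespace OffPolicyTD

/-- `Y` is a Markov chain with transition matrix `Q` (and arbitrary initial law). -/
structure IsMarkovChain {T Ω : Type*} [MeasurableSpace T] [MeasurableSpace Ω]
    (Q : Matrix T T ℝ) (ℙ : Measure Ω) (Y : ℕ → Ω → T) : Prop where
  measurable : ∀ n, Measurable (Y n)
  step : ∀ (n : ℕ) (y : ℕ → T), ℙ.real {ω | ∀ i ≤ n + 1, Y i ω = y i} =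
    ℙ.real {ω | ∀ i ≤ n, Y i ω = y i} * Q (y n) (y (n + 1))

namespace IsMarkovChain

variable {T : Type*} [Fintype T] [DecidableEq T] [MeasurableSpace T] [DiscreteMeasurableSpace T]
  {Ω : Type*} [MeasurableSpace Ω] {ℙ : Measure Ω} [IsProbabilityMeasure ℙ]
  {Q : Matrix T T ℝ} {Y : ℕ → Ω → T}

theorem measurable_comp (hY : IsMarkovChain Q ℙ Y) (G : T → ℝ) (n : ℕ) :
    Measurable fun ω => G (Y n ω) :=
  (Measurable.of_discrete (f := G)).comp (hY.measurable n)

theorem measurableSet_cylinder (hY : IsMarkovChain Q ℙ Y) (n : ℕ) (y : ℕ → T) :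
    MeasurableSet {ω | ∀ i ≤ n, Y i ω = y i} := by
  have : {ω | ∀ i ≤ n, Y i ω = y i} = ⋂ i, ⋂ (_ : i ≤ n), Y i ⁻¹' {y i} := by
    ext ω; simp
  rw [this]
  exact MeasurableSet.iInter fun i => MeasurableSet.iInter fun _ =>
    hY.measurable i (MeasurableSet.of_discrete)

theorem integrable_comp (hY : IsMarkovChain Q ℙ Y) (G : T → ℝ) (n : ℕ) :
    Integrable (fun ω => G (Y n ω)) ℙ := by
  refine Integrable.of_bound (hY.measurable_comp G n).aestronglyMeasurable (∑ z, |G z|)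
    (ae_of_all _ fun ω => ?_)
  exact Finset.single_le_sum (f := fun z => |G z|) (fun _ _ => abs_nonneg _) (Finset.mem_univ _)

/-- Induction on the lag, for all `t` at once: splitting the cylinder by the value of `Y (t + 1)`
costs one factor `Q` and lowers the lag by one. -/
theorem setIntegral_cylinder (hY : IsMarkovChain Q ℙ Y) (G : T → ℝ) (n : ℕ) :
    ∀ (t : ℕ) (y : ℕ → T), ∫ ω in {ω | ∀ i ≤ t, Y i ω = y i}, G (Y (t + n) ω) ∂ℙ =
      ℙ.real {ω | ∀ i ≤ t, Y i ω = y i} * (Q ^ n *ᵥ G) (y t) := by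
  induction n with
  | zero =>
    intro t y
    rw [setIntegral_congr_fun (g := fun _ => G (y t)) (hY.measurableSet_cylinder t y)]
    · simp
    · intro ω hω
      simp [hω t le_rfl]
  | succ n ih =>
    intro t y
    have hupd : ∀ z, ∀ i ≤ t, Function.update y (t + 1) z i = y i := fun z i hi =>
      Function.update_of_ne (by omega) _ _
    have hunion : {ω | ∀ i ≤ t, Y i ω = y i} =
        ⋃ z, {ω | ∀ i ≤ t + 1, Y i ω = Function.update y (t + 1) z i} := by
      ext ω
      simp only [Set.mem_ofPred_eq, Set.mem_iUnion]
      constructor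
      · intro h
        refine ⟨Y (t + 1) ω, fun i hi => ?_⟩
        rcases Nat.le_succ_iff.1 hi with hi' | rfl
        · rw [hupd _ i hi', h i hi']
        · simp
      · rintro ⟨z, hz⟩ i hi
        rw [hz i (by omega), hupd z i hi]
    have hcyl : ∀ z, {ω | ∀ i ≤ t, Y i ω = Function.update y (t + 1) z i} =
        {ω | ∀ i ≤ t, Y i ω = y i} := fun z => by
      ext ω
      exact forall₂_congr fun i hi => by rw [hupd z i hi]
    have hterm : ∀ z, ∫ ω in {ω | ∀ i ≤ t + 1, Y i ω = Function.update y (t + 1) z i},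
        G (Y (t + (n + 1)) ω) ∂ℙ =
        ℙ.real {ω | ∀ i ≤ t, Y i ω = y i} * (Q (y t) z * (Q ^ n *ᵥ G) z) := by
      intro z
      rw [show t + (n + 1) = t + 1 + n by ring, ih (t + 1), hY.step, hcyl, hupd z t le_rfl,
        Function.update_self, mul_assoc]
    conv_lhs => rw [hunion]
    rw [integral_iUnion_fintype (fun z => hY.measurableSet_cylinder _ _) _
      (fun z => (hY.integrable_comp G _).integrableOn)]
    · simp_rw [hterm]
      rw [← Finset.mul_sum, pow_succ', ← Matrix.mulVec_mulVec]
      rfl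
    · intro z z' hzz'
      refine Set.disjoint_left.2 fun ω h h' => hzz' ?_
      have h1 := h (t + 1) le_rfl
      have h2 := h' (t + 1) le_rfl
      rw [Function.update_self] at h1 h2
      exact h1.symm.trans h2

/-- The Markov property, for functionals `φ` of the path up to time `t`. -/
theorem integral_mul_comp (hY : IsMarkovChain Q ℙ Y) {t : ℕ} {φ : (ℕ → T) → ℝ}
    (hφ : ∀ y y' : ℕ → T, (∀ i ≤ t, y i = y' i) → φ y = φ y') (G : T → ℝ) (n : ℕ) :
    ∫ ω, φ (fun i => Y i ω) * G (Y (t + n) ω) ∂ℙ =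
      ∫ ω, φ (fun i => Y i ω) * (Q ^ n *ᵥ G) (Y t ω) ∂ℙ := by
  -- A finite path is frozen after time `t`. Its cylinders partition `Ω`, and `φ` is constant on
  -- each of them.
  let extend : (Fin (t + 1) → T) → ℕ → T := fun c i => c ⟨min i t, by omega⟩
  have hunion : (Set.univ : Set Ω) = ⋃ c, {ω | ∀ i ≤ t, Y i ω = extend c i} := by
    refine (Set.eq_univ_of_forall fun ω => Set.mem_iUnion.2
      ⟨fun i : Fin (t + 1) => Y i ω, ?_⟩).symm
    intro i hi
    simp [extend, hi]
  have hdisj : Pairwise (Function.onFun Disjoint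
      fun c => {ω | ∀ i ≤ t, Y i ω = extend c i}) := by
    intro c c' hcc'
    refine Set.disjoint_left.2 fun ω h h' => hcc' (funext fun i => ?_)
    have h1 := (h i (by omega)).symm.trans (h' i (by omega))
    have h2 : min (i : ℕ) t = i := by omega
    simpa [extend, h2] using h1
  have hEq : ∀ (F : T → ℝ) (m : ℕ) c, Set.EqOn (fun ω => φ (fun i => Y i ω) * F (Y m ω))
      (fun ω => φ (extend c) * F (Y m ω)) {ω | ∀ i ≤ t, Y i ω = extend c i} := by
    intro F m c ω hω
    simp only
    rw [hφ _ (extend c) hω]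
  have hint : ∀ (F : T → ℝ) (m : ℕ) c, IntegrableOn (fun ω => φ (fun i => Y i ω) * F (Y m ω))
      {ω | ∀ i ≤ t, Y i ω = extend c i} ℙ := fun F m c =>
    ((hY.integrable_comp F m).const_mul (φ (extend c))).integrableOn.congr_fun (hEq F m c).symm
      (hY.measurableSet_cylinder _ _)
  rw [← setIntegral_univ, hunion, integral_iUnion_fintype
    (fun c => hY.measurableSet_cylinder _ _) hdisj (hint G (t + n)), ← setIntegral_univ, hunion,
    integral_iUnion_fintype (fun c => hY.measurableSet_cylinder _ _) hdisj (hint _ t)]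
  refine Finset.sum_congr rfl fun c _ => ?_
  rw [setIntegral_congr_fun (hY.measurableSet_cylinder _ _) (hEq G (t + n) c),
    setIntegral_congr_fun (hY.measurableSet_cylinder _ _) (hEq _ t c), integral_const_mul,
    integral_const_mul, hY.setIntegral_cylinder]
  have := hY.setIntegral_cylinder (Q ^ n *ᵥ G) 0 t (extend c)
  rw [add_zero, pow_zero, Matrix.one_mulVec] at this
  rw [this]

end IsMarkovChain

end OffPolicyTD

/-! ### Almost sure convergence of weighted series of correlated variables -/

namespace OffPolicyTD

/-- Tonelli: the sum of the `|D k|` has finite expectation, hence is almost surely finite. -/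
theorem ae_summable_of_integral_abs_le {Ω : Type*} [MeasurableSpace Ω] {ℙ : Measure Ω}
    {D : ℕ → Ω → ℝ} (hD : ∀ k, Integrable (D k) ℙ) {a : ℕ → ℝ}
    (ha : ∀ k, ∫ ω, |D k ω| ∂ℙ ≤ a k) (hs : Summable a) :
    ∀ᵐ ω ∂ℙ, Summable fun k => |D k ω| := by
  have ha0 : ∀ k, 0 ≤ a k := fun k => (integral_nonneg fun _ => abs_nonneg _).trans (ha k)
  have hfin : ∫⁻ ω, ∑' k, ‖D k ω‖ₑ ∂ℙ ≠ ⊤ := by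
    rw [lintegral_tsum fun k => (hD k).aestronglyMeasurable.enorm]
    have hle : ∀ k, ∫⁻ ω, ‖D k ω‖ₑ ∂ℙ ≤ ENNReal.ofReal (a k) := by
      intro k
      rw [← ofReal_integral_norm_eq_lintegral_enorm (hD k)]
      exact ENNReal.ofReal_le_ofReal (ha k)
    refine ne_top_of_le_ne_top ?_ (ENNReal.tsum_le_tsum hle)
    rw [← ENNReal.ofReal_tsum_of_nonneg ha0 hs]
    exact ENNReal.ofReal_ne_top
  have hmeas : AEMeasurable (fun ω => ∑' k, ‖D k ω‖ₑ) ℙ :=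
    AEMeasurable.tsum fun k => (hD k).aestronglyMeasurable.enorm
  filter_upwards [ae_lt_top' hmeas hfin] with ω hω
  have := ENNReal.tsum_coe_ne_top_iff_summable.1 (hω.ne : ∑' k, ((‖D k ω‖₊ : NNReal) : ENNReal) ≠ ⊤)
  simpa using NNReal.summable_coe.2 this

/-- A sequence converges if its increments along a subsequence are summable and its oscillation
between consecutive terms of the subsequence vanishes. -/
theorem exists_tendsto_of_blocks {u : ℕ → ℝ} {N : ℕ → ℕ} (hN : Tendsto N atTop atTop)
    (hsum : Summable fun k => |u (N (k + 1)) - u (N k)|) {ε : ℕ → ℝ}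
    (hε : Tendsto ε atTop (𝓝 0))
    (hosc : ∀ k n, N k ≤ n → n < N (k + 1) → |u n - u (N k)| ≤ ε k) :
    ∃ L, Tendsto u atTop (𝓝 L) := by
  have hcau : CauchySeq fun k => u (N k) := by
    refine cauchySeq_of_summable_dist (hsum.congr fun k => ?_)
    rw [Real.dist_eq, abs_sub_comm]
  obtain ⟨L, hL⟩ := cauchySeq_tendsto_of_complete hcau
  refine ⟨L, Metric.tendsto_atTop.2 fun δ hδ => ?_⟩
  obtain ⟨K₁, hK₁⟩ := Metric.tendsto_atTop.1 hL (δ / 2) (by positivity)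
  obtain ⟨K₂, hK₂⟩ := eventually_atTop.1 (hε.eventually (gt_mem_nhds (by positivity : 0 < δ / 2)))
  set K := max K₁ K₂ with hK
  refine ⟨N K, fun n hn => ?_⟩
  have hex : ∃ j, n < N (K + j) := by
    obtain ⟨M, hM⟩ := eventually_atTop.1 (hN.eventually_gt_atTop n)
    exact ⟨M, hM _ (by omega)⟩
  classical
  obtain ⟨k, hkK, hk1, hk2⟩ : ∃ k ≥ K, N k ≤ n ∧ n < N (k + 1) := by
    have hspec := Nat.find_spec hex
    rcases hj : Nat.find hex with _ | j
    · rw [hj] at hspec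
      simp only [add_zero] at hspec
      omega
    · refine ⟨K + j, by omega, ?_, ?_⟩
      · exact not_lt.1 (Nat.find_min hex (m := j) (by omega))
      · rw [hj] at hspec
        exact hspec
  have h1 := hK₁ k (by omega)
  have h2 := hK₂ k (by omega)
  have h3 := hosc k n hk1 hk2
  rw [Real.dist_eq] at h1 ⊢
  calc |u n - L| = |(u n - u (N k)) + (u (N k) - L)| := by ring_nf
    _ ≤ _ := abs_add_le _ _
    _ < δ := by linarith

/-- Second moment of a weighted sum of bounded variables with summable correlations. -/
theorem integral_sq_sum_le {Ω : Type*} [MeasurableSpace Ω] {ℙ : Measure Ω}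
    [IsProbabilityMeasure ℙ] {X : ℕ → Ω → ℝ} (hX : ∀ t, Measurable (X t)) {C : ℝ}
    (hC : ∀ t ω, |X t ω| ≤ C) {V : ℕ → ℝ}
    (hV : ∀ s N, ∑ t ∈ Finset.Ico s N, |∫ ω, X s ω * X t ω ∂ℙ| ≤ V s)
    {α : ℕ → ℝ} (hα0 : ∀ t, 0 ≤ α t) (hα : Antitone α) (m n : ℕ) :
    ∫ ω, (∑ t ∈ Finset.Ico m n, α t * X t ω) ^ 2 ∂ℙ ≤
      2 * ∑ s ∈ Finset.Ico m n, α s ^ 2 * V s := by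
  have hint : ∀ s t, Integrable (fun ω => X s ω * X t ω) ℙ := fun s t =>
    Integrable.of_bound ((hX s).mul (hX t)).aestronglyMeasurable (C * C) (ae_of_all _ fun ω => by
      rw [Real.norm_eq_abs, abs_mul]
      exact mul_le_mul (hC s ω) (hC t ω) (abs_nonneg _) ((abs_nonneg _).trans (hC s ω)))
  set c : ℕ → ℕ → ℝ := fun s t => α s * α t * |∫ ω, X s ω * X t ω ∂ℙ| with hc
  have hc0 : ∀ s t, 0 ≤ c s t := fun s t =>
    mul_nonneg (mul_nonneg (hα0 s) (hα0 t)) (abs_nonneg _)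
  have hcs : ∀ s t, c s t = c t s := fun s t => by
    simp only [hc, mul_comm (α s), mul_comm (X s _)]
  have hexp : ∫ ω, (∑ t ∈ Finset.Ico m n, α t * X t ω) ^ 2 ∂ℙ =
      ∑ s ∈ Finset.Ico m n, ∑ t ∈ Finset.Ico m n, α s * α t * ∫ ω, X s ω * X t ω ∂ℙ := by
    have : ∀ ω, (∑ t ∈ Finset.Ico m n, α t * X t ω) ^ 2 =
        ∑ s ∈ Finset.Ico m n, ∑ t ∈ Finset.Ico m n, α s * α t * (X s ω * X t ω) := fun ω => by
      rw [sq, Finset.sum_mul_sum]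
      exact Finset.sum_congr rfl fun s _ => Finset.sum_congr rfl fun t _ => by ring
    simp_rw [this]
    rw [integral_finsetSum _ fun s _ => integrable_finsetSum _ fun t _ => (hint s t).const_mul _]
    refine Finset.sum_congr rfl fun s _ => ?_
    rw [integral_finsetSum _ fun t _ => (hint s t).const_mul _]
    exact Finset.sum_congr rfl fun t _ => integral_const_mul _ _
  -- Symmetrisation, counting the diagonal twice. It leaves pairs `s ≤ t`, for which `α s * α t ≤ α
  -- s ^ 2`.
  have hle : ∑ s ∈ Finset.Ico m n, ∑ t ∈ Finset.Ico m n, α s * α t * ∫ ω, X s ω * X t ω ∂ℙ ≤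
      ∑ s ∈ Finset.Ico m n, ∑ t ∈ Finset.Ico m n,
        ((if s ≤ t then c s t else 0) + if t ≤ s then c t s else 0) := by
    refine Finset.sum_le_sum fun s _ => Finset.sum_le_sum fun t _ => ?_
    have h1 : α s * α t * ∫ ω, X s ω * X t ω ∂ℙ ≤ c s t :=
      mul_le_mul_of_nonneg_left (le_abs_self _) (mul_nonneg (hα0 s) (hα0 t))
    have h2 := hc0 s t
    rw [← hcs s t]
    split_ifs with h3 h4 h4
    · linarith
    · linarith
    · linarith
    · omega
  have hrow : ∀ s ∈ Finset.Ico m n,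
      ∑ t ∈ Finset.Ico m n, (if s ≤ t then c s t else 0) ≤ α s ^ 2 * V s := by
    intro s hs
    rw [← Finset.sum_filter]
    have hfil : (Finset.Ico m n).filter (fun t => s ≤ t) = Finset.Ico s n := by
      ext t
      simp only [Finset.mem_filter, Finset.mem_Ico] at hs ⊢
      omega
    rw [hfil]
    calc _ ≤ ∑ t ∈ Finset.Ico s n, α s ^ 2 * |∫ ω, X s ω * X t ω ∂ℙ| := by
          refine Finset.sum_le_sum fun t ht => mul_le_mul_of_nonneg_right ?_ (abs_nonneg _)
          rw [sq]
          exact mul_le_mul_of_nonneg_left (hα (Finset.mem_Ico.1 ht).1) (hα0 s)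
      _ ≤ _ := by
          rw [← Finset.mul_sum]
          exact mul_le_mul_of_nonneg_left (hV s n) (sq_nonneg _)
  rw [hexp]
  refine hle.trans ?_
  simp_rw [Finset.sum_add_distrib]
  rw [Finset.sum_comm (f := fun s t => if t ≤ s then c t s else 0), ← two_mul]
  exact mul_le_mul_of_nonneg_left (Finset.sum_le_sum hrow) (by norm_num)

/-- Bernoulli's inequality for `(x / (x + 1)) ^ p = (1 - 1 / (x + 1)) ^ p`. -/
theorem rpow_succ_sub_le {p : ℝ} (hp : 1 ≤ p) {x : ℝ} (hx : 0 < x) :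
    (x + 1) ^ p - x ^ p ≤ p * (x + 1) ^ (p - 1) := by
  have hx1 : 0 < x + 1 := by linarith
  have h := one_add_mul_self_le_rpow_one_add (s := -(1 / (x + 1))) (by
    rw [neg_le_neg_iff, div_le_one hx1]; linarith) hp
  have h2 : 1 + -(1 / (x + 1)) = x / (x + 1) := by field_simp; ring
  rw [h2, Real.div_rpow hx.le hx1.le, le_div_iff₀ (by positivity)] at h
  rw [Real.rpow_sub_one hx1.ne']
  have h3 : (1 + p * -(1 / (x + 1))) * (x + 1) ^ p = (x + 1) ^ p - p * ((x + 1) ^ p / (x + 1)) := by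
    field_simp
    ring
  linarith

/-- The block boundaries `⌈(k+1)^p⌉`. -/
noncomputable def blockStart (p : ℝ) (k : ℕ) : ℕ := ⌈((k : ℝ) + 1) ^ p⌉₊

theorem le_blockStart (p : ℝ) (k : ℕ) : ((k : ℝ) + 1) ^ p ≤ blockStart p k := Nat.le_ceil _

theorem blockStart_mono {p : ℝ} (hp : 0 ≤ p) : Monotone (blockStart p) := by
  intro i j hij
  refine Nat.ceil_mono (Real.rpow_le_rpow (by positivity) ?_ hp)
  exact_mod_cast Nat.succ_le_succ hij

theorem tendsto_blockStart {p : ℝ} (hp : 1 ≤ p) : Tendsto (blockStart p) atTop atTop := by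
  refine tendsto_atTop_mono (fun k => ?_) tendsto_id
  have h1 : (k : ℝ) + 1 ≤ ((k : ℝ) + 1) ^ p :=
    Real.self_le_rpow_of_one_le (by linarith [k.cast_nonneg (α := ℝ)]) hp
  have := h1.trans (le_blockStart p k)
  have h2 : (k : ℝ) ≤ blockStart p k := by linarith
  exact_mod_cast h2

/-- The rounding error is at most one, hence at most `(k + 2) ^ (p - 1)`; this accounts for `p + 1`.
The power of two comes from `k + 2 ≤ 2 * (k + 1)`. -/
theorem blockStart_succ_sub_le {p : ℝ} (hp : 1 ≤ p) (k : ℕ) :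
    (blockStart p (k + 1) : ℝ) - blockStart p k ≤
      (p + 1) * 2 ^ (p - 1) * ((k : ℝ) + 1) ^ (p - 1) := by
  set x : ℝ := (k : ℝ) + 1 with hx
  have hx1 : 1 ≤ x := by linarith [k.cast_nonneg (α := ℝ)]
  have hx0 : 0 < x := by linarith
  have h1 : (blockStart p (k + 1) : ℝ) ≤ (x + 1) ^ p + 1 := by
    have := (Nat.ceil_lt_add_one (a := (((k + 1 : ℕ) : ℝ) + 1) ^ p) (by positivity)).le
    simpa [blockStart, hx] using this
  have h2 := le_blockStart p k
  have h3 := rpow_succ_sub_le hp hx0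
  have h4 : 1 ≤ (x + 1) ^ (p - 1) := Real.one_le_rpow (by linarith) (by linarith)
  have h5 : (x + 1) ^ (p - 1) ≤ 2 ^ (p - 1) * x ^ (p - 1) := by
    rw [← Real.mul_rpow (by norm_num) hx0.le]
    exact Real.rpow_le_rpow (by linarith) (by linarith) (by linarith)
  calc _ ≤ (p + 1) * (x + 1) ^ (p - 1) := by linarith
    _ ≤ _ := by
      rw [mul_assoc]
      exact mul_le_mul_of_nonneg_left h5 (by linarith)

theorem stepSize_nonneg {Cα : ℝ} (hCα : 0 < Cα) (ν : ℝ) (t : ℕ) : 0 ≤ stepSize Cα ν t := by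
  unfold stepSize; positivity

theorem stepSize_antitone {Cα ν : ℝ} (hCα : 0 < Cα) (hν : 0 ≤ ν) : Antitone (stepSize Cα ν) := by
  intro s t hst
  unfold stepSize
  refine div_le_div_of_nonneg_left hCα.le (by positivity) (Real.rpow_le_rpow (by positivity) ?_ hν)
  have : (s : ℝ) ≤ t := by exact_mod_cast hst
  linarith

theorem stepSize_eq (Cα ν : ℝ) (t : ℕ) : stepSize Cα ν t = Cα * ((t : ℝ) + 1) ^ (-ν) := by
  rw [stepSize, Real.rpow_neg (by positivity), div_eq_mul_inv]

/-- Almost sure convergence of a series of bounded variables weighted by polynomial step sizes,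
when the total correlation of the `s`-th variable with the later ones is `O((s+1)^κ)`,
`κ < 3ν - 2`. -/
theorem ae_exists_tendsto_sum_stepSize {Ω : Type*} [MeasurableSpace Ω] {ℙ : Measure Ω}
    [IsProbabilityMeasure ℙ] {X : ℕ → Ω → ℝ} (hX : ∀ t, Measurable (X t)) {C : ℝ}
    (hC : ∀ t ω, |X t ω| ≤ C) {Cα ν κ CV : ℝ} (hCα : 0 < Cα) (hν1 : ν ≤ 1) (hκ0 : 0 ≤ κ)
    (hκ : κ < 3 * ν - 2) (hCV : 0 ≤ CV)
    (hV : ∀ s N, ∑ t ∈ Finset.Ico s N, |∫ ω, X s ω * X t ω ∂ℙ| ≤ CV * ((s : ℝ) + 1) ^ κ) :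
    ∀ᵐ ω ∂ℙ, ∃ L, Tendsto (fun n => ∑ t ∈ Finset.range n, stepSize Cα ν t * X t ω)
      atTop (𝓝 L) := by
  have hν0 : 0 < ν := by linarith
  have hC0 : 0 ≤ C := by
    obtain ⟨ω⟩ : Nonempty Ω := nonempty_of_isProbabilityMeasure ℙ
    exact (abs_nonneg _).trans (hC 0 ω)
  have hνκ : 0 < ν - κ := by linarith
  -- Two things are needed: the oscillation within a block, of order `k^(p-1-pν)`, must vanish, and
  -- the root mean square of a block sum, of order `k^(-e/2)`, must be summable. For this `p` one
  -- has `e - 2 = 1 - p + pν`, so both amount to `κ < 3ν - 2`.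
  set p : ℝ := 2 / (ν - κ) with hp
  have hpm : p * (ν - κ) = 2 := by rw [hp]; field_simp
  have hp0 : 0 < p := by positivity
  have hp1 : 1 ≤ p := by rw [hp, le_div_iff₀ hνκ]; linarith
  have hexp1 : p - 1 - p * ν < 0 := by nlinarith
  set e : ℝ := p * (2 * ν - κ) - p + 1 with he
  have he2 : 2 < e := by nlinarith
  set Cp : ℝ := (p + 1) * 2 ^ (p - 1) with hCp
  have hCp0 : 0 ≤ Cp := by positivity
  set N := blockStart p with hN
  have hstart : ∀ k t, N k ≤ t → ((k : ℝ) + 1) ^ p ≤ (t : ℝ) + 1 := fun k t ht => by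
    have h1 := le_blockStart p k
    have h2 : (N k : ℝ) ≤ t := by exact_mod_cast ht
    linarith
  have hcount : ∀ k n, N k ≤ n → n ≤ N (k + 1) →
      ((Finset.Ico (N k) n).card : ℝ) ≤ Cp * ((k : ℝ) + 1) ^ (p - 1) := fun k n h1 h2 => by
    have h3 : (n : ℝ) ≤ N (k + 1) := by exact_mod_cast h2
    rw [Nat.card_Ico, Nat.cast_sub h1]
    exact (sub_le_sub_right h3 _).trans (blockStart_succ_sub_le hp1 k)
  have hk1 : ∀ k : ℕ, (0 : ℝ) < (k : ℝ) + 1 := fun k => by positivity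
  have hαk : ∀ k t, N k ≤ t → stepSize Cα ν t ≤ Cα * ((k : ℝ) + 1) ^ (-(p * ν)) := by
    intro k t ht
    rw [stepSize_eq, ← mul_neg, Real.rpow_mul (hk1 k).le]
    refine mul_le_mul_of_nonneg_left ?_ hCα.le
    exact Real.rpow_le_rpow_of_nonpos (by have := hk1 k; positivity) (hstart k t ht) (by linarith)
  set u : Ω → ℕ → ℝ := fun ω n => ∑ t ∈ Finset.range n, stepSize Cα ν t * X t ω with hu
  have hdiff : ∀ ω m n, m ≤ n → u ω n - u ω m =
      ∑ t ∈ Finset.Ico m n, stepSize Cα ν t * X t ω := fun ω m n hmn =>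
    (Finset.sum_Ico_eq_sub _ hmn).symm
  have hNmono : ∀ k, N k ≤ N (k + 1) := fun k => blockStart_mono hp0.le k.le_succ
  set D : ℕ → Ω → ℝ := fun k ω => u ω (N (k + 1)) - u ω (N k) with hD
  have hmeasu : ∀ n, Measurable fun ω => u ω n := fun n =>
    Finset.measurable_sum _ fun t _ => (hX t).const_mul _
  have hosc : ∀ ω k n, N k ≤ n → n ≤ N (k + 1) →
      |u ω n - u ω (N k)| ≤ Cp * Cα * C * ((k : ℝ) + 1) ^ (p - 1 - p * ν) := by
    intro ω k n h1 h2
    rw [hdiff ω _ _ h1]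
    calc _ ≤ ∑ t ∈ Finset.Ico (N k) n, |stepSize Cα ν t * X t ω| :=
          Finset.abs_sum_le_sum_abs _ _
      _ ≤ ∑ t ∈ Finset.Ico (N k) n, Cα * ((k : ℝ) + 1) ^ (-(p * ν)) * C := by
          refine Finset.sum_le_sum fun t ht => ?_
          rw [abs_mul, abs_of_nonneg (stepSize_nonneg hCα ν t)]
          have := hk1 k
          exact mul_le_mul (hαk k t (Finset.mem_Ico.1 ht).1) (hC t ω) (abs_nonneg _) (by positivity)
      _ ≤ Cp * ((k : ℝ) + 1) ^ (p - 1) * (Cα * ((k : ℝ) + 1) ^ (-(p * ν)) * C) := by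
          rw [Finset.sum_const, nsmul_eq_mul]
          have := hk1 k
          exact mul_le_mul_of_nonneg_right (hcount k n h1 h2) (by positivity)
      _ = _ := by
          rw [sub_eq_add_neg (p - 1), Real.rpow_add (hk1 k)]
          ring
  have hDbound : ∀ k ω, |D k ω| ≤ Cp * Cα * C * ((k : ℝ) + 1) ^ (p - 1 - p * ν) := fun k ω =>
    hosc ω k _ (hNmono k) le_rfl
  have hDmeas : ∀ k, Measurable (D k) := fun k => (hmeasu _).sub (hmeasu _)
  have hDint : ∀ k, Integrable (D k) ℙ := fun k =>
    Integrable.of_bound (hDmeas k).aestronglyMeasurable _ (ae_of_all _ (hDbound k))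
  have hD2int : ∀ k, Integrable (fun ω => D k ω ^ 2) ℙ := fun k =>
    Integrable.of_bound ((hDmeas k).pow_const 2).aestronglyMeasurable
      ((Cp * Cα * C * ((k : ℝ) + 1) ^ (p - 1 - p * ν)) ^ 2) (ae_of_all _ fun ω => by
        rw [Real.norm_eq_abs, abs_pow]
        exact pow_le_pow_left₀ (abs_nonneg _) (hDbound k ω) 2)
  set C2 : ℝ := 2 * (Cp * (Cα ^ 2 * CV)) with hC2
  have hD2 : ∀ k, ∫ ω, D k ω ^ 2 ∂ℙ ≤ C2 * ((k : ℝ) + 1) ^ (-e) := by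
    intro k
    have h1 : ∫ ω, D k ω ^ 2 ∂ℙ ≤
        2 * ∑ s ∈ Finset.Ico (N k) (N (k + 1)), stepSize Cα ν s ^ 2 * (CV * ((s : ℝ) + 1) ^ κ) := by
      simp only [hD, hdiff _ _ _ (hNmono k)]
      exact integral_sq_sum_le hX hC hV (stepSize_nonneg hCα ν) (stepSize_antitone hCα hν0.le) _ _
    refine h1.trans ?_
    rw [hC2, mul_assoc 2]
    refine mul_le_mul_of_nonneg_left ?_ (by norm_num)
    calc _ ≤ ∑ s ∈ Finset.Ico (N k) (N (k + 1)),
          Cα ^ 2 * CV * ((k : ℝ) + 1) ^ (p * (κ - 2 * ν)) := by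
          refine Finset.sum_le_sum fun s hs => ?_
          have hs0 : (0 : ℝ) < (s : ℝ) + 1 := hk1 s
          have h2 : stepSize Cα ν s ^ 2 * (CV * ((s : ℝ) + 1) ^ κ) =
              Cα ^ 2 * CV * ((s : ℝ) + 1) ^ (κ - 2 * ν) := by
            rw [stepSize_eq, mul_pow, ← Real.rpow_natCast (_ ^ (-ν)), ← Real.rpow_mul hs0.le,
              show κ - 2 * ν = -ν * ((2 : ℕ) : ℝ) + κ by push_cast; ring, Real.rpow_add hs0]
            ring
          rw [h2, Real.rpow_mul (hk1 k).le]
          refine mul_le_mul_of_nonneg_left ?_ (by positivity)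
          exact Real.rpow_le_rpow_of_nonpos (by have := hk1 k; positivity)
            (hstart k s (Finset.mem_Ico.1 hs).1) (by linarith)
      _ ≤ Cp * ((k : ℝ) + 1) ^ (p - 1) *
          (Cα ^ 2 * CV * ((k : ℝ) + 1) ^ (p * (κ - 2 * ν))) := by
          rw [Finset.sum_const, nsmul_eq_mul]
          have := hk1 k
          exact mul_le_mul_of_nonneg_right (hcount k _ (hNmono k) le_rfl) (by positivity)
      _ = _ := by
          rw [show -e = (p - 1) + p * (κ - 2 * ν) by rw [he]; ring, Real.rpow_add (hk1 k)]
          ring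
  have hD1 : ∀ k, ∫ ω, |D k ω| ∂ℙ ≤ (1 + C2) * ((k : ℝ) + 1) ^ (-(e / 2)) := by
    intro k
    -- The inequality `d ≤ 1/a + a d²` with the weight `a` balancing both terms replaces
    -- Cauchy–Schwarz.
    have hpt : ∀ ω, |D k ω| ≤ ((k : ℝ) + 1) ^ (-(e / 2)) + ((k : ℝ) + 1) ^ (e / 2) * D k ω ^ 2 := by
      intro ω
      have ha : 0 < ((k : ℝ) + 1) ^ (e / 2) := Real.rpow_pos_of_pos (hk1 k) _
      rw [Real.rpow_neg (hk1 k).le]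
      set a := ((k : ℝ) + 1) ^ (e / 2)
      rw [← sub_nonneg, ← sq_abs (D k ω)]
      have : a⁻¹ + a * |D k ω| ^ 2 - |D k ω| =
          a⁻¹ * ((1 - a * |D k ω| / 2) ^ 2 + 3 / 4 * (a * |D k ω|) ^ 2) := by
        field_simp
        ring
      rw [this]
      positivity
    calc _ ≤ ∫ ω, ((k : ℝ) + 1) ^ (-(e / 2)) + ((k : ℝ) + 1) ^ (e / 2) * D k ω ^ 2 ∂ℙ :=
          integral_mono (hDint k).abs ((integrable_const _).add ((hD2int k).const_mul _)) hpt
      _ = ((k : ℝ) + 1) ^ (-(e / 2)) + ((k : ℝ) + 1) ^ (e / 2) * ∫ ω, D k ω ^ 2 ∂ℙ := by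
          rw [integral_add (integrable_const _) ((hD2int k).const_mul _), integral_const_mul]
          simp
      _ ≤ ((k : ℝ) + 1) ^ (-(e / 2)) +
          ((k : ℝ) + 1) ^ (e / 2) * (C2 * ((k : ℝ) + 1) ^ (-e)) := by
          have := hk1 k
          gcongr
          exact hD2 k
      _ = _ := by
          rw [show -e = -(e / 2) + -(e / 2) by ring, Real.rpow_add (hk1 k),
            Real.rpow_neg (hk1 k).le]
          have : ((k : ℝ) + 1) ^ (e / 2) ≠ 0 := (Real.rpow_pos_of_pos (hk1 k) _).ne'
          field_simp
  have hsummable : Summable fun k : ℕ => (1 + C2) * ((k : ℝ) + 1) ^ (-(e / 2)) := by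
    refine Summable.mul_left _ ?_
    have := (summable_nat_add_iff 1).2 (Real.summable_nat_rpow.2 (by linarith : -(e / 2) < -1))
    exact this.congr fun k => by push_cast; rfl
  have hε : Tendsto (fun k : ℕ => Cp * Cα * C * ((k : ℝ) + 1) ^ (p - 1 - p * ν)) atTop (𝓝 0) := by
    rw [← mul_zero (Cp * Cα * C)]
    refine Tendsto.const_mul _ ?_
    have h1 : Tendsto (fun k : ℕ => (k : ℝ) + 1) atTop atTop :=
      tendsto_atTop_add_const_right _ _ tendsto_natCast_atTop_atTop
    have h2 := (tendsto_rpow_neg_atTop (neg_pos.2 hexp1)).comp h1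
    rw [neg_neg] at h2
    exact h2
  filter_upwards [ae_summable_of_integral_abs_le hDint hD1 hsummable] with ω hω
  exact exists_tendsto_of_blocks (tendsto_blockStart hp1) hω hε
    fun k n h1 h2 => hosc ω k n h1 h2.le

end OffPolicyTD

/-! ### Delayed products along a mixing chain -/

namespace OffPolicyTD

namespace IsMarkovChain

variable {T : Type*} [Fintype T] [DecidableEq T] [MeasurableSpace T] [DiscreteMeasurableSpace T]
  {Ω : Type*} [MeasurableSpace Ω] {ℙ : Measure Ω} [IsProbabilityMeasure ℙ]
  {Q : Matrix T T ℝ} {Y : ℕ → Ω → T}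

/-- Covariances of an observable of a geometrically mixing chain decay geometrically. -/
theorem abs_integral_centered_mul_le (hY : IsMarkovChain Q ℙ Y) {h : T → ℝ} {c D A : ℝ}
    (hD : ∀ y, |h y - c| ≤ D) (n : ℕ) (hA : ∀ y, |(Q ^ n *ᵥ h) y - c| ≤ A) (s : ℕ) :
    |∫ ω, (h (Y s ω) - c) * (h (Y (s + n) ω) - c) ∂ℙ| ≤ D * A := by
  have hφ := hY.integral_mul_comp (t := s) (φ := fun y => h (y s) - c)
    (fun y y' hyy' => by simp only [hyy' s le_rfl]) h n
  have hmul : ∀ (F : T → ℝ) (m : ℕ),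
      Integrable (fun ω => (h (Y s ω) - c) * F (Y m ω)) ℙ := fun F m =>
    (hY.integrable_comp F m).bdd_mul
      ((hY.measurable_comp h s).sub_const c).aestronglyMeasurable
      (ae_of_all _ fun ω => hD (Y s ω))
  have hc : Integrable (fun ω => (h (Y s ω) - c) * c) ℙ :=
    ((hY.integrable_comp h s).sub (integrable_const c)).mul_const c
  have heq : ∫ ω, (h (Y s ω) - c) * (h (Y (s + n) ω) - c) ∂ℙ =
      ∫ ω, (h (Y s ω) - c) * ((Q ^ n *ᵥ h) (Y s ω) - c) ∂ℙ := by
    simp_rw [mul_sub _ _ c]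
    rw [integral_sub (hmul h _) hc, integral_sub (hmul _ s) hc, hφ]
  rw [heq, ← Real.norm_eq_abs]
  refine (norm_integral_le_of_norm_le_const (C := D * A) (ae_of_all _ fun ω => ?_)).trans ?_
  · rw [Real.norm_eq_abs, abs_mul]
    exact mul_le_mul (hD _) (hA _) (abs_nonneg _) ((abs_nonneg _).trans (hD (Y s ω)))
  · simp

/-- The prediction error of `g (Y (t + n))` given the path up to time `t` is uncorrelated with
every functional of that path. -/
theorem integral_mul_prediction_error (hY : IsMarkovChain Q ℙ Y) {t : ℕ} {φ : (ℕ → T) → ℝ}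
    (hφ : ∀ y y' : ℕ → T, (∀ i ≤ t, y i = y' i) → φ y = φ y')
    (hφm : Measurable fun ω => φ fun i => Y i ω) {D : ℝ} (hD : ∀ y, |φ y| ≤ D)
    (g : T → ℝ) (n : ℕ) :
    ∫ ω, φ (fun i => Y i ω) * (g (Y (t + n) ω) - (Q ^ n *ᵥ g) (Y t ω)) ∂ℙ = 0 := by
  have hmul : ∀ (F : T → ℝ) (m : ℕ),
      Integrable (fun ω => φ (fun i => Y i ω) * F (Y m ω)) ℙ := fun F m =>
    (hY.integrable_comp F m).bdd_mul hφm.aestronglyMeasurable (ae_of_all _ fun ω => hD _)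
  simp_rw [mul_sub]
  rw [integral_sub (hmul _ _) (hmul _ _), hY.integral_mul_comp hφ, sub_self]

/-- Convergence of the weighted fluctuations of a product of two observables of a geometrically
mixing chain evaluated at times `t` and `t + f t`. -/
theorem ae_exists_tendsto_sum_product (hY : IsMarkovChain Q ℙ Y) {m : (T → ℝ) → ℝ} {χ C₀ : ℝ}
    (hχ : χ ∈ Set.Ioo (0 : ℝ) 1) (hC₀ : 0 ≤ C₀)
    (hmix : ∀ (u : T → ℝ) (D : ℝ), (∀ y, |u y| ≤ D) →
      ∀ n y, |(Q ^ n *ᵥ u) y - m u| ≤ C₀ * D * χ ^ n)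
    {Cα ν κ Cf : ℝ} (hCα : 0 < Cα) (hν1 : ν ≤ 1) (hκ0 : 0 ≤ κ) (hκ : κ < 3 * ν - 2)
    (hCf : 0 ≤ Cf) {f : ℕ → ℕ} (hf : ∀ t, (f t : ℝ) ≤ Cf * ((t : ℝ) + 1) ^ κ)
    (hfs : Summable fun t => χ ^ f t) (g h : T → ℝ) :
    ∀ᵐ ω ∂ℙ, ∃ L, Tendsto (fun N => ∑ t ∈ Finset.range N,
      stepSize Cα ν t * (g (Y (t + f t) ω) * h (Y t ω) - m g * m h)) atTop (𝓝 L) := by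
  have hbd : ∀ u : T → ℝ, ∃ D, 0 ≤ D ∧ ∀ y, |u y| ≤ D := fun u =>
    ⟨∑ y, |u y|, Finset.sum_nonneg fun _ _ => abs_nonneg _, fun y =>
      Finset.single_le_sum (f := fun y => |u y|) (fun _ _ => abs_nonneg _) (Finset.mem_univ y)⟩
  obtain ⟨Dg, hDg0, hDg⟩ := hbd g
  obtain ⟨Dh, hDh0, hDh⟩ := hbd h
  have hχn : ∀ n : ℕ, χ ^ n ≤ 1 := fun n => pow_le_one₀ hχ.1.le hχ.2.le
  have hone : ∀ s : ℕ, 1 ≤ ((s : ℝ) + 1) ^ κ := fun s =>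
    Real.one_le_rpow (by linarith [s.cast_nonneg (α := ℝ)]) hκ0
  -- the prediction error of the delayed observable
  set Dp : ℝ := Dg + (|m g| + C₀ * Dg) with hDp
  have hDp0 : 0 ≤ Dp := by positivity
  have herr : ∀ n y y', |g y - (Q ^ n *ᵥ g) y'| ≤ Dp := by
    intro n y y'
    have h1 : |(Q ^ n *ᵥ g) y'| ≤ |m g| + C₀ * Dg := by
      have h2 := hmix g Dg hDg n y'
      have h3 : C₀ * Dg * χ ^ n ≤ C₀ * Dg := mul_le_of_le_one_right (by positivity) (hχn n)
      have h4 := abs_sub_abs_le_abs_sub ((Q ^ n *ᵥ g) y') (m g)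
      linarith
    exact (abs_sub _ _).trans (add_le_add (hDg y) h1)
  -- The fluctuation is `X t + h(Y_t) (Q^{f t} g(Y_t) - m g) + m g (h(Y_t) - m h)`: prediction
  -- error, bias and centered observable.
  set X : ℕ → Ω → ℝ := fun t ω =>
    h (Y t ω) * (g (Y (t + f t) ω) - (Q ^ f t *ᵥ g) (Y t ω)) with hXdef
  have hXm : ∀ t, Measurable (X t) := fun t =>
    (hY.measurable_comp h t).mul ((hY.measurable_comp g _).sub (hY.measurable_comp _ t))
  have hXb : ∀ t ω, |X t ω| ≤ Dh * Dp := fun t ω => by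
    rw [abs_mul]
    exact mul_le_mul (hDh _) (herr _ _ _) (abs_nonneg _) hDh0
  -- Once `s + f s ≤ t`, both `X s` and `h (Y t)` are functionals of the path up to `t`. Only `f s`
  -- lags survive, so the total correlation is `O(f s)`.
  have hXcor : ∀ s t, s + f s ≤ t → s ≤ t → ∫ ω, X s ω * X t ω ∂ℙ = 0 := by
    intro s t hst hst'
    have := hY.integral_mul_prediction_error (t := t)
      (φ := fun y => h (y s) * (g (y (s + f s)) - (Q ^ f s *ᵥ g) (y s)) * h (y t))
      (fun y y' hyy' => by simp only [hyy' s hst', hyy' _ hst, hyy' t le_rfl])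
      ((hXm s).mul (hY.measurable_comp h t)) (D := Dh * Dp * Dh)
      (fun y => by
        rw [abs_mul, abs_mul]
        exact mul_le_mul (mul_le_mul (hDh _) (herr _ _ _) (abs_nonneg _) hDh0) (hDh _)
          (abs_nonneg _) (by positivity)) g (f t)
    rw [← this]
    refine integral_congr_ae (ae_of_all _ fun ω => ?_)
    simp only [hXdef]
    ring
  have hX1 : ∀ s t, |∫ ω, X s ω * X t ω ∂ℙ| ≤ (Dh * Dp) ^ 2 := by
    intro s t
    rw [← Real.norm_eq_abs]
    refine (norm_integral_le_of_norm_le_const (C := (Dh * Dp) ^ 2) (ae_of_all _ fun ω => ?_)).trans ?_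
    · rw [Real.norm_eq_abs, abs_mul, sq]
      exact mul_le_mul (hXb s ω) (hXb t ω) (abs_nonneg _) (by positivity)
    · simp
  have hXV : ∀ s N, ∑ t ∈ Finset.Ico s N, |∫ ω, X s ω * X t ω ∂ℙ| ≤
      (Dh * Dp) ^ 2 * Cf * ((s : ℝ) + 1) ^ κ := by
    intro s N
    calc _ ≤ ∑ t ∈ Finset.Ico s N, (if t ∈ Finset.Ico s (s + f s) then (Dh * Dp) ^ 2 else 0) := by
          refine Finset.sum_le_sum fun t ht => ?_
          have hst := (Finset.mem_Ico.1 ht).1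
          split_ifs with h1
          · exact hX1 s t
          · rw [Finset.mem_Ico, not_and, not_lt] at h1
            rw [hXcor s t (h1 hst) hst, abs_zero]
      _ ≤ ∑ t ∈ Finset.Ico s (s + f s), (Dh * Dp) ^ 2 := by
          rw [← Finset.sum_filter]
          refine Finset.sum_le_sum_of_subset_of_nonneg (fun t ht => ?_)
            fun _ _ _ => by positivity
          exact (Finset.mem_filter.1 ht).2
      _ = (Dh * Dp) ^ 2 * f s := by simp [mul_comm]
      _ ≤ _ := by
          rw [mul_assoc]
          exact mul_le_mul_of_nonneg_left (hf s) (by positivity)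
  -- the centered current observable
  set Z : ℕ → Ω → ℝ := fun t ω => h (Y t ω) - m h
  set Dz : ℝ := Dh + |m h| with hDz
  have hDz0 : 0 ≤ Dz := by positivity
  have hZb' : ∀ y, |h y - m h| ≤ Dz := fun y =>
    (abs_sub _ _).trans (add_le_add_left (hDh y) _)
  have hZV : ∀ s N, ∑ t ∈ Finset.Ico s N, |∫ ω, Z s ω * Z t ω ∂ℙ| ≤
      Dz * (C₀ * Dh) * (1 - χ)⁻¹ * ((s : ℝ) + 1) ^ κ := by
    intro s N
    have hpos : 0 ≤ Dz * (C₀ * Dh) := by positivity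
    have hinv : 0 ≤ (1 - χ)⁻¹ := inv_nonneg.2 (by linarith [hχ.2])
    rw [Finset.sum_Ico_eq_sum_range]
    calc _ ≤ ∑ n ∈ Finset.range (N - s), Dz * (C₀ * Dh) * χ ^ n := by
          refine Finset.sum_le_sum fun n _ => ?_
          rw [mul_assoc]
          exact hY.abs_integral_centered_mul_le hZb' n (hmix h Dh hDh n) s
      _ ≤ Dz * (C₀ * Dh) * (1 - χ)⁻¹ := by
          rw [← Finset.mul_sum]
          refine mul_le_mul_of_nonneg_left ?_ hpos
          rw [← tsum_geometric_of_lt_one hχ.1.le hχ.2]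
          exact (summable_geometric_of_lt_one hχ.1.le hχ.2).sum_le_tsum _
            fun n _ => pow_nonneg hχ.1.le n
      _ ≤ _ := le_mul_of_one_le_right (by positivity) (hone s)
  have hinv : 0 ≤ (1 - χ)⁻¹ := inv_nonneg.2 (by linarith [hχ.2])
  have hconvX := ae_exists_tendsto_sum_stepSize (ℙ := ℙ) hXm hXb hCα hν1 hκ0 hκ
    (by positivity) hXV
  have hconvZ := ae_exists_tendsto_sum_stepSize (ℙ := ℙ)
    (fun t => (hY.measurable_comp h t).sub_const (m h)) (fun t ω => hZb' (Y t ω)) hCα hν1 hκ0 hκ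
    (by positivity) hZV
  filter_upwards [hconvX, hconvZ] with ω hω₁ hω₂
  obtain ⟨L₁, hL₁⟩ := hω₁
  obtain ⟨L₂, hL₂⟩ := hω₂
  -- the bias of the delayed observable
  have hsum : Summable fun t =>
      stepSize Cα ν t * (h (Y t ω) * ((Q ^ f t *ᵥ g) (Y t ω) - m g)) := by
    refine Summable.of_norm_bounded (hfs.mul_left (Cα * (Dh * (C₀ * Dg)))) fun t => ?_
    rw [Real.norm_eq_abs, abs_mul, abs_mul, abs_of_nonneg (stepSize_nonneg hCα ν t),
      mul_assoc Cα, mul_assoc Dh]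
    have h0 : stepSize Cα ν t ≤ Cα := by
      have := stepSize_antitone hCα (by linarith : 0 ≤ ν) (Nat.zero_le t)
      simpa [stepSize] using this
    exact mul_le_mul h0 (mul_le_mul (hDh _) (hmix g Dg hDg _ _) (abs_nonneg _) hDh0)
      (by positivity) hCα.le
  refine ⟨_, ((hL₁.add hsum.hasSum.tendsto_sum_nat).add (hL₂.const_mul (m g))).congr fun N => ?_⟩
  rw [Finset.mul_sum, ← Finset.sum_add_distrib, ← Finset.sum_add_distrib]
  refine Finset.sum_congr rfl fun t _ => ?_
  simp only [hXdef]
  ring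

end IsMarkovChain

end OffPolicyTD

/-! ### The chain of transitions `(S_t, A_t, S_{t+1})` -/

namespace OffPolicyTD

variable {S Act : Type*} [Fintype S] [Fintype Act]

namespace FiniteMDP

theorem transition_row_sum (M : FiniteMDP S Act) (μ : Policy S Act) (s : S) :
    ∑ s', M.transition μ s s' = 1 := by
  simp only [FiniteMDP.transition, Matrix.of_apply]
  rw [Finset.sum_comm]
  simp [← Finset.mul_sum, M.p_sum, μ.prob_sum]

/-- The transition matrix of the chain of triples `(S_t, A_t, S_{t+1})`. -/
noncomputable def tripleTransition [DecidableEq S] (M : FiniteMDP S Act) (μ : Policy S Act) :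
    Matrix (S × Act × S) (S × Act × S) ℝ :=
  Matrix.of fun y y' => if y.2.2 = y'.1 then μ.prob y'.1 y'.2.1 * M.p y'.1 y'.2.1 y'.2.2 else 0

/-- The conditional mean of an observable of `(S_t, A_t, S_{t+1})` given `S_t`. -/
noncomputable def condMean (M : FiniteMDP S Act) (μ : Policy S Act) (g : S × Act × S → ℝ) (s : S) :
    ℝ :=
  ∑ a, ∑ s', μ.prob s a * M.p s a s' * g (s, a, s')

/-- The stationary mean of an observable of `(S_t, A_t, S_{t+1})`. -/
noncomputable def stationaryMean (M : FiniteMDP S Act) (μ : Policy S Act)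
    (g : S × Act × S → ℝ) : ℝ :=
  M.stationaryDist μ ⬝ᵥ M.condMean μ g

theorem tripleTransition_mulVec [DecidableEq S] (M : FiniteMDP S Act) (μ : Policy S Act)
    (g : S × Act × S → ℝ) (y : S × Act × S) :
    (M.tripleTransition μ *ᵥ g) y = M.condMean μ g y.2.2 := by
  simp only [Matrix.mulVec, dotProduct, tripleTransition, Matrix.of_apply, condMean,
    Fintype.sum_prod_type]
  rw [Finset.sum_eq_single y.2.2]
  · simp
  · intro s _ hs
    simp [hs.symm]
  · simp

/-- A triple influences the future only through its last state, which is already the first state of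
the next triple; hence `n + 1` steps of triples are `n` steps of states. -/
theorem tripleTransition_pow_succ_mulVec [DecidableEq S] [DecidableEq Act] (M : FiniteMDP S Act)
    (μ : Policy S Act) (g : S × Act × S → ℝ) (n : ℕ) (y : S × Act × S) :
    (M.tripleTransition μ ^ (n + 1) *ᵥ g) y =
      (M.transition μ ^ n *ᵥ M.condMean μ g) y.2.2 := by
  induction n generalizing y with
  | zero => simp [tripleTransition_mulVec]
  | succ n ih =>
    rw [pow_succ', ← Matrix.mulVec_mulVec, tripleTransition_mulVec, pow_succ' (M.transition μ),
      ← Matrix.mulVec_mulVec]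
    simp only [condMean, ih]
    rw [Finset.sum_comm]
    simp only [Matrix.mulVec, dotProduct, FiniteMDP.transition, Matrix.of_apply, Finset.sum_mul]

theorem abs_condMean_le (M : FiniteMDP S Act) (μ : Policy S Act) {g : S × Act × S → ℝ} {D : ℝ}
    (hD : ∀ y, |g y| ≤ D) (s : S) : |M.condMean μ g s| ≤ D := by
  have hw : ∀ a s', 0 ≤ μ.prob s a * M.p s a s' := fun a s' =>
    mul_nonneg (μ.prob_nonneg s a) (M.p_nonneg s a s')
  calc _ ≤ ∑ a, ∑ s', |μ.prob s a * M.p s a s' * g (s, a, s')| :=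
        (Finset.abs_sum_le_sum_abs _ _).trans
          (Finset.sum_le_sum fun a _ => Finset.abs_sum_le_sum_abs _ _)
    _ ≤ ∑ a, ∑ s', μ.prob s a * M.p s a s' * D := by
        refine Finset.sum_le_sum fun a _ => Finset.sum_le_sum fun s' _ => ?_
        rw [abs_mul, abs_of_nonneg (hw a s')]
        exact mul_le_mul_of_nonneg_left (hD _) (hw a s')
    _ = D := by simp [← Finset.sum_mul, ← Finset.mul_sum, M.p_sum, μ.prob_sum]

theorem abs_stationaryMean_le (M : FiniteMDP S Act) (μ : Policy S Act) {g : S × Act × S → ℝ}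
    {D : ℝ} (hD : ∀ y, |g y| ≤ D) : |M.stationaryMean μ g| ≤ D := by
  obtain ⟨h0, h1, -⟩ := M.stationaryDist_spec μ
  calc _ ≤ ∑ s, |M.stationaryDist μ s * M.condMean μ g s| := Finset.abs_sum_le_sum_abs _ _
    _ ≤ ∑ s, M.stationaryDist μ s * D := by
        refine Finset.sum_le_sum fun s _ => ?_
        rw [abs_mul, abs_of_nonneg (h0 s)]
        exact mul_le_mul_of_nonneg_left (M.abs_condMean_le μ hD s) (h0 s)
    _ = D := by rw [← Finset.sum_mul, h1, one_mul]

/-- Mixing is inherited from the state chain. The triple chain itself may fail to be irreducible,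
since some triples may have probability zero. -/
theorem exists_tripleTransition_mixing [DecidableEq S] [DecidableEq Act] (M : FiniteMDP S Act)
    (μ : Policy S Act) (hirr : (M.transition μ).IsIrreducible)
    (haper : IsAperiodic (M.transition μ)) :
    ∃ χ ∈ Set.Ioo (0 : ℝ) 1, ∃ C : ℝ, 0 ≤ C ∧
      ∀ (g : S × Act × S → ℝ) (D : ℝ), (∀ y, |g y| ≤ D) → ∀ n y,
        |(M.tripleTransition μ ^ n *ᵥ g) y - M.stationaryMean μ g| ≤ C * D * χ ^ n := by
  obtain ⟨χ, hχ, C, hC, hmix⟩ := geometric_ergodicity hirr haper (M.transition_row_sum μ)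
    (M.stationaryDist_spec μ)
  have hχ0 := hχ.1
  -- The `2` covers lag zero, and `C / χ` pays for the step lost in passing from triples to states.
  refine ⟨χ, hχ, 2 + C / χ, by positivity, fun g D hD n y => ?_⟩
  have hD0 : 0 ≤ D := (abs_nonneg _).trans (hD y)
  rcases n with _ | n
  · rw [pow_zero, Matrix.one_mulVec, pow_zero, mul_one]
    calc _ ≤ |g y| + |M.stationaryMean μ g| := abs_sub _ _
      _ ≤ D + D := add_le_add (hD y) (M.abs_stationaryMean_le μ hD)
      _ ≤ _ := by
        have : 0 ≤ C / χ * D := by positivity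
        linarith
  · rw [tripleTransition_pow_succ_mulVec]
    calc _ ≤ C * D * χ ^ n := hmix _ D (M.abs_condMean_le μ hD) n _
      _ = C / χ * D * χ ^ (n + 1) := by rw [pow_succ]; field_simp
      _ ≤ _ := by gcongr; linarith

section Trajectory

variable {M : FiniteMDP S Act} {μ : Policy S Act} {Ω : Type*} [MeasurableSpace Ω]
  {ℙ : Measure Ω} {St : ℕ → Ω → S} {At : ℕ → Ω → Act}

theorem IsTrajectory.measurableSet_cylinder (h : M.IsTrajectory μ ℙ St At) (n : ℕ) (s : ℕ → S)
    (a : ℕ → Act) : MeasurableSet {ω | ∀ i ≤ n, St i ω = s i ∧ At i ω = a i} := by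
  have : {ω | ∀ i ≤ n, St i ω = s i ∧ At i ω = a i} =
      ⋂ i, ⋂ (_ : i ≤ n), ({ω | St i ω = s i} ∩ {ω | At i ω = a i}) := by
    ext ω; simp
  rw [this]
  exact MeasurableSet.iInter fun i => MeasurableSet.iInter fun _ =>
    (h.measurable_state i _).inter (h.measurable_action i _)

/-- The action at time `n + 1` is summed out of `law`, because a triple ends in a state. -/
theorem IsTrajectory.law_next_state [IsProbabilityMeasure ℙ]
    (h : M.IsTrajectory μ ℙ St At) (n : ℕ) (s : ℕ → S) (a : ℕ → Act) (s' : S) :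
    ℙ.real {ω | (∀ i ≤ n, St i ω = s i ∧ At i ω = a i) ∧ St (n + 1) ω = s'} =
      ℙ.real {ω | ∀ i ≤ n, St i ω = s i ∧ At i ω = a i} * M.p (s n) (a n) s' := by
  classical
  set s₁ := Function.update s (n + 1) s' with hs₁
  have hs : ∀ i ≤ n, s₁ i = s i := fun i hi => Function.update_of_ne (by omega) _ _
  have ha : ∀ (b : Act), ∀ i ≤ n, Function.update a (n + 1) b i = a i := fun b i hi =>
    Function.update_of_ne (by omega) _ _
  have hset : {ω | (∀ i ≤ n, St i ω = s i ∧ At i ω = a i) ∧ St (n + 1) ω = s'} =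
      ⋃ b ∈ Finset.univ,
        {ω | ∀ i ≤ n + 1, St i ω = s₁ i ∧ At i ω = Function.update a (n + 1) b i} := by
    ext ω
    simp only [Set.mem_ofPred_eq, Set.mem_iUnion, Finset.mem_univ, exists_prop, true_and]
    constructor
    · rintro ⟨h1, h2⟩
      refine ⟨At (n + 1) ω, fun i hi => ?_⟩
      rcases Nat.le_succ_iff.1 hi with hi' | rfl
      · rw [hs i hi', ha _ i hi']; exact h1 i hi'
      · simp [hs₁, h2]
    · rintro ⟨b, hb⟩
      refine ⟨fun i hi => ?_, ?_⟩
      · have := hb i (by omega)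
        rwa [hs i hi, ha b i hi] at this
      · simpa [hs₁] using (hb (n + 1) le_rfl).1
  have hterm : ∀ b, ℙ.real {ω | ∀ i ≤ n + 1, St i ω = s₁ i ∧
      At i ω = Function.update a (n + 1) b i} =
      ℙ.real {ω | ∀ i ≤ n, St i ω = s i ∧ At i ω = a i} * M.p (s n) (a n) s' * μ.prob s' b := by
    intro b
    rw [h.law, h.law, Finset.prod_range_succ, hs n le_rfl, ha b n le_rfl, hs 0 (Nat.zero_le _),
      ha b 0 (Nat.zero_le _), hs₁, Function.update_self, Function.update_self, ← hs₁]
    have hprod : ∏ i ∈ Finset.range n, M.p (s₁ i) (Function.update a (n + 1) b i) (s₁ (i + 1)) *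
        μ.prob (s₁ (i + 1)) (Function.update a (n + 1) b (i + 1)) =
        ∏ i ∈ Finset.range n, M.p (s i) (a i) (s (i + 1)) * μ.prob (s (i + 1)) (a (i + 1)) := by
      refine Finset.prod_congr rfl fun i hi => ?_
      have hi' := Finset.mem_range.1 hi
      rw [hs i hi'.le, hs (i + 1) hi', ha b i hi'.le, ha b (i + 1) hi']
    rw [hprod]
    ring
  rw [hset, measureReal_biUnion_finset]
  · simp_rw [hterm]
    rw [← Finset.mul_sum, μ.prob_sum, mul_one]
  · intro b _ b' _ hbb'
    refine Set.disjoint_left.2 fun ω h1 h2 => hbb' ?_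
    have h3 := (h1 (n + 1) le_rfl).2
    have h4 := (h2 (n + 1) le_rfl).2
    rw [Function.update_self] at h3 h4
    exact h3.symm.trans h4
  · exact fun b _ => h.measurableSet_cylinder _ _ _

/-- The triples `(S_t, A_t, S_{t+1})` form a Markov chain. -/
theorem IsTrajectory.isMarkovChain [DecidableEq S] [MeasurableSpace (S × Act × S)]
    [DiscreteMeasurableSpace (S × Act × S)] [IsProbabilityMeasure ℙ] (h : M.IsTrajectory μ ℙ St At) :
    IsMarkovChain (M.tripleTransition μ) ℙ fun t ω => (St t ω, At t ω, St (t + 1) ω) where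
  measurable n := by
    refine measurable_to_countable' fun y => ?_
    have : (fun ω => (St n ω, At n ω, St (n + 1) ω)) ⁻¹' {y} =
        {ω | St n ω = y.1} ∩ {ω | At n ω = y.2.1} ∩ {ω | St (n + 1) ω = y.2.2} := by
      ext ω
      simp [Prod.ext_iff, and_assoc]
    rw [this]
    exact ((h.measurable_state _ _).inter (h.measurable_action _ _)).inter (h.measurable_state _ _)
  step n y := by
    have hcyl : ∀ n, (∀ i < n, (y i).2.2 = (y (i + 1)).1) →
        {ω | ∀ i ≤ n, (St i ω, At i ω, St (i + 1) ω) = y i} =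
        {ω | (∀ i ≤ n, St i ω = (y i).1 ∧ At i ω = (y i).2.1) ∧ St (n + 1) ω = (y n).2.2} := by
      intro n hcons
      ext ω
      simp only [Set.mem_ofPred_eq, Prod.ext_iff]
      constructor
      · exact fun h1 => ⟨fun i hi => ⟨(h1 i hi).1, (h1 i hi).2.1⟩, (h1 n le_rfl).2.2⟩
      · rintro ⟨h1, h2⟩ i hi
        refine ⟨(h1 i hi).1, (h1 i hi).2, ?_⟩
        rcases hi.lt_or_eq with hi' | rfl
        · rw [hcons i hi', (h1 (i + 1) hi').1]
        · exact h2
    have hempty : ∀ n, (∃ i < n, (y i).2.2 ≠ (y (i + 1)).1) →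
        {ω | ∀ i ≤ n, (St i ω, At i ω, St (i + 1) ω) = y i} = ∅ := by
      rintro n ⟨i, hi, hne⟩
      refine Set.eq_empty_of_forall_notMem fun ω hω => hne ?_
      have h1 := hω i hi.le
      have h2 := hω (i + 1) hi
      rw [← h1, ← h2]
    -- A sequence of triples that do not chain up has an empty cylinder; the transition matrix
    -- vanishes where the chaining breaks at the last step.
    by_cases hn : (y n).2.2 = (y (n + 1)).1
    · by_cases hcons : ∀ i < n, (y i).2.2 = (y (i + 1)).1
      · have hcons' : ∀ i < n + 1, (y i).2.2 = (y (i + 1)).1 := fun i hi => by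
          rcases Nat.lt_succ_iff_lt_or_eq.1 hi with hi' | rfl
          · exact hcons i hi'
          · exact hn
        rw [hcyl n hcons, hcyl (n + 1) hcons',
          h.law_next_state n (fun i => (y i).1) (fun i => (y i).2.1),
          h.law_next_state (n + 1) (fun i => (y i).1) (fun i => (y i).2.1),
          h.law (n + 1) (fun i => (y i).1) (fun i => (y i).2.1),
          h.law n (fun i => (y i).1) (fun i => (y i).2.1), Finset.prod_range_succ]
        simp only [tripleTransition, Matrix.of_apply, if_pos hn]
        rw [hn]
        ring
      · push Not at hcons
        obtain ⟨i, hi, hne⟩ := hcons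
        rw [hempty n ⟨i, hi, hne⟩, hempty (n + 1) ⟨i, by omega, hne⟩]
        simp
    · rw [hempty (n + 1) ⟨n, by omega, hn⟩]
      simp [tripleTransition, hn]

end Trajectory

end FiniteMDP

end OffPolicyTD

/-! ### Importance weighted samples and the linear form of the algorithm -/

namespace OffPolicyTD

variable {S Act : Type*} [Fintype S] [Fintype Act] {K : ℕ}

/-- Where `μ` vanishes the quotient is `0` by convention, and coverage makes `π` vanish too. -/
theorem mul_ratio {π μ : Policy S Act} (hcov : Covers μ π) (s : S) (a : Act) :
    μ.prob s a * ratio π μ s a = π.prob s a := by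
  rw [ratio]
  rcases eq_or_ne (μ.prob s a) 0 with h | h
  · have : ¬ 0 < π.prob s a := fun h1 => (hcov s a h1).ne' h
    rw [h, zero_mul]
    exact le_antisymm (π.prob_nonneg s a) (not_lt.1 this)
  · field_simp

namespace FiniteMDP

variable (M : FiniteMDP S Act) (π μ : Policy S Act) (x : S → Fin K → ℝ)

theorem condMean_ratio_mul {π μ : Policy S Act} (hcov : Covers μ π) (g : S × Act × S → ℝ) (s : S) :
    M.condMean μ (fun y => ratio π μ y.1 y.2.1 * g y) s = M.condMean π g s := by
  simp only [condMean]
  refine Finset.sum_congr rfl fun a _ => Finset.sum_congr rfl fun s' _ => ?_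
  rw [← mul_ratio hcov s a]
  ring

/-- The importance weighted one-transition sample of the matrix `A`. -/
noncomputable def sampleMatrix (y : S × Act × S) : Matrix (Fin K) (Fin K) ℝ :=
  ratio π μ y.1 y.2.1 • vecMulVec (x y.1) (M.γ • x y.2.2 - x y.1)

/-- The importance weighted one-transition sample of the vector `b`. -/
noncomputable def sampleVector (y : S × Act × S) : Fin K → ℝ :=
  (ratio π μ y.1 y.2.1 * M.r y.1 y.2.1) • x y.1

theorem stationaryMean_sampleMatrix [DecidableEq S] {π μ : Policy S Act} (hcov : Covers μ π)
    (j k : Fin K) :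
    M.stationaryMean μ (fun y => M.sampleMatrix π μ x y j k) = M.tdMatrix π μ x j k := by
  have h1 : ∀ s, M.condMean μ (fun y => M.sampleMatrix π μ x y j k) s =
      x s j * (M.γ * ∑ s', M.transition π s s' * x s' k - x s k) := by
    intro s
    have : (fun y => M.sampleMatrix π μ x y j k) = fun y : S × Act × S =>
        ratio π μ y.1 y.2.1 * (x y.1 j * (M.γ * x y.2.2 k - x y.1 k)) := by
      ext y
      simp [sampleMatrix, vecMulVec_apply]
    rw [this, condMean_ratio_mul M hcov]
    have h2 : ∑ a, ∑ s', π.prob s a * M.p s a s' = 1 := by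
      simp [← Finset.mul_sum, M.p_sum, π.prob_sum]
    simp only [condMean, FiniteMDP.transition, Matrix.of_apply, Finset.sum_mul]
    rw [Finset.sum_comm (γ := S), mul_sub, Finset.mul_sum, Finset.mul_sum]
    have h3 : x s j * x s k = ∑ a, ∑ s', π.prob s a * M.p s a s' * (x s j * x s k) := by
      simp_rw [← Finset.sum_mul]
      rw [h2, one_mul]
    rw [h3, ← Finset.sum_sub_distrib]
    refine Finset.sum_congr rfl fun a _ => ?_
    rw [Finset.mul_sum, Finset.mul_sum, ← Finset.sum_sub_distrib]
    exact Finset.sum_congr rfl fun s' _ => by ring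
  rw [stationaryMean, tdMatrix, Matrix.mul_assoc, Matrix.mul_apply]
  refine Finset.sum_congr rfl fun s _ => ?_
  rw [h1, Matrix.mul_diagonal, Matrix.sub_mul, Matrix.smul_mul, Matrix.one_mul, Matrix.sub_apply,
    Matrix.smul_apply, Matrix.mul_apply]
  simp only [featureMatrix, Matrix.transpose_apply, Matrix.of_apply, smul_eq_mul]
  ring

theorem stationaryMean_sampleVector [DecidableEq S] {π μ : Policy S Act} (hcov : Covers μ π)
    (j : Fin K) :
    M.stationaryMean μ (fun y => M.sampleVector π μ x y j) = M.tdVector π μ x j := by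
  have h1 : ∀ s, M.condMean μ (fun y => M.sampleVector π μ x y j) s =
      x s j * M.rewardVec π s := by
    intro s
    have : (fun y => M.sampleVector π μ x y j) = fun y : S × Act × S =>
        ratio π μ y.1 y.2.1 * (M.r y.1 y.2.1 * x y.1 j) := by
      ext y
      simp [sampleVector, mul_assoc]
    rw [this, condMean_ratio_mul M hcov]
    simp only [condMean, rewardVec, Finset.mul_sum]
    refine Finset.sum_congr rfl fun a _ => ?_
    simp_rw [mul_assoc, ← Finset.mul_sum, ← Finset.sum_mul, M.p_sum]
    ring
  rw [stationaryMean, tdVector, Matrix.mulVec, dotProduct, dotProduct]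
  refine Finset.sum_congr rfl fun s _ => ?_
  rw [h1, Matrix.mul_diagonal]
  simp only [featureMatrix, Matrix.transpose_apply, Matrix.of_apply]
  ring

/-- The iterates follow a linear recursion driven by delayed products of samples. -/
theorem iterates_succ (α : ℕ → ℝ) (f : ℕ → ℕ) (w₀ : Fin K → ℝ) (s : ℕ → S) (a : ℕ → Act) (t : ℕ) :
    M.iterates π μ x α f w₀ s a (t + 1) = M.iterates π μ x α f w₀ s a t + α t •
      (-(M.sampleMatrix π μ x (s (t + f t), a (t + f t), s (t + f t + 1)))ᵀ *ᵥ
        (M.sampleMatrix π μ x (s t, a t, s (t + 1)) *ᵥ M.iterates π μ x α f w₀ s a t +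
          M.sampleVector π μ x (s t, a t, s (t + 1)))) := by
  rw [iterates]
  congr 2
  -- The delayed factor `ρ (x - γ x') xᵀ` is minus the transposed matrix sample, and `ρ_t δ_t x_t`
  -- is the current matrix sample applied to `w` plus the vector sample.
  rw [← Matrix.smul_mulVec]
  congr 1
  · ext i j
    simp [sampleMatrix, vecMulVec_apply]
    ring
  · rw [sampleMatrix, sampleVector, Matrix.smul_mulVec, vecMulVec_mulVec, tdError]
    ext i
    simp only [sub_dotProduct, smul_dotProduct, Pi.add_apply, Pi.smul_apply, smul_eq_mul,
      MulOpposite.smul_eq_mul_unop, MulOpposite.unop_op]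
    ring

end FiniteMDP

end OffPolicyTD

/-! ### Step sizes and the recursion in coordinates -/

namespace OffPolicyTD

theorem tendsto_stepSize (Cα : ℝ) {ν : ℝ} (hν : 0 < ν) :
    Tendsto (stepSize Cα ν) atTop (𝓝 0) := by
  have h1 : Tendsto (fun t : ℕ => (t : ℝ) + 1) atTop atTop :=
    tendsto_atTop_add_const_right _ _ tendsto_natCast_atTop_atTop
  have h2 := ((tendsto_rpow_neg_atTop hν).comp h1).const_mul Cα
  rw [mul_zero] at h2
  exact h2.congr fun t => (stepSize_eq Cα ν t).symm

theorem tendsto_sum_stepSize {Cα ν : ℝ} (hCα : 0 < Cα) (hν1 : ν ≤ 1) :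
    Tendsto (fun n => ∑ t ∈ Finset.range n, stepSize Cα ν t) atTop atTop := by
  refine tendsto_atTop_mono (fun n => Finset.sum_le_sum fun t _ => ?_)
    ((Real.tendsto_sum_range_one_div_nat_succ_atTop.const_mul_atTop hCα).congr fun n =>
      Finset.mul_sum _ _ _)
  rw [stepSize, mul_one_div]
  refine div_le_div_of_nonneg_left hCα.le (by positivity) ?_
  conv_rhs => rw [← Real.rpow_one ((t : ℝ) + 1)]
  exact Real.rpow_le_rpow_of_exponent_le (by linarith [t.cast_nonneg (α := ℝ)]) hν1

/-- The coefficients are functions of two triples from a finite set, so they are bounded in any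
norm. -/
theorem exists_forall_norm_le_of_finite_range {ι E F : Type*} [SeminormedAddCommGroup F] {B : ι → E}
    (hB : (Set.range B).Finite) (Φ : E → F) : ∃ M, ∀ t, ‖Φ (B t)‖ ≤ M := by
  obtain ⟨M, hM⟩ := (hB.image fun e => ‖Φ e‖).bddAbove
  exact ⟨M, fun t => hM ⟨B t, ⟨t, rfl⟩, rfl⟩⟩

/-- A linear recursion in `ℝᴷ` whose mean dynamics is `w ↦ -Aᵀ (A w + b)` converges to the solution
of `A w + b = 0` whenever its weighted fluctuations form convergent series. -/
theorem tendsto_of_matrix_recursion {K : ℕ} {α : ℕ → ℝ} (hα : ∀ t, 0 ≤ α t)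
    (hα0 : Tendsto α atTop (𝓝 0))
    (hαs : Tendsto (fun n => ∑ t ∈ Finset.range n, α t) atTop atTop)
    {B : ℕ → Matrix (Fin K) (Fin K) ℝ} {c : ℕ → Fin K → ℝ} (hB : (Set.range B).Finite)
    (hc : (Set.range c).Finite) {A : Matrix (Fin K) (Fin K) ℝ} (hA : IsUnit A) {b w' : Fin K → ℝ}
    (hw' : A *ᵥ w' + b = 0) {LB : Matrix (Fin K) (Fin K) ℝ} {Lc : Fin K → ℝ}
    (hLB : Tendsto (fun n => ∑ t ∈ Finset.range n, α t • (B t - -(Aᵀ * A))) atTop (𝓝 LB))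
    (hLc : Tendsto (fun n => ∑ t ∈ Finset.range n, α t • (c t - -(Aᵀ *ᵥ b))) atTop (𝓝 Lc))
    {w : ℕ → Fin K → ℝ} (hw : ∀ t, w (t + 1) = w t + α t • (B t *ᵥ w t + c t)) :
    Tendsto w atTop (𝓝 w') := by
  -- The Gram contraction needs an inner product, so matrices act on `EuclideanSpace` rather than on
  -- `Fin K → ℝ` with its sup norm.
  let Φ := toEuclideanCLM (n := Fin K) (𝕜 := ℝ)
  have hΦcont : Continuous Φ :=
    (Φ.toAlgEquiv.toLinearMap : Matrix (Fin K) (Fin K) ℝ →ₗ[ℝ] _).continuous_of_finiteDimensional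
  have hΦgram : Φ (-(Aᵀ * A)) = -(ContinuousLinearMap.adjoint (Φ A) ∘L Φ A) := by
    rw [map_neg, map_mul, ← conjTranspose_eq_transpose_of_trivial A, ← star_eq_conjTranspose,
      map_star, ContinuousLinearMap.star_eq_adjoint]
    rfl
  have hfix : -(Aᵀ * A) *ᵥ w' + -(Aᵀ *ᵥ b) = 0 := by
    rw [neg_mulVec, ← mulVec_mulVec, ← neg_add, ← mulVec_add, hw', mulVec_zero, neg_zero]
  -- the Gram operator of `A` is bounded below
  have hdet := (Matrix.isUnit_iff_isUnit_det A).1 hA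
  -- The added `1` keeps the denominator positive when `K = 0`.
  set m : ℝ := 1 / (‖Φ A⁻¹‖ + 1) ^ 2 with hm
  have hm0 : 0 < m := by positivity
  have hlow : ∀ v, m * ‖v‖ ^ 2 ≤ ‖Φ A v‖ ^ 2 := by
    intro v
    have h1 : Φ A⁻¹ (Φ A v) = v := by
      rw [← mul_apply_eq_comp, ← map_mul, Matrix.nonsing_inv_mul A hdet, map_one]
      rfl
    have h2 : ‖v‖ ≤ (‖Φ A⁻¹‖ + 1) * ‖Φ A v‖ := by
      calc ‖v‖ = ‖Φ A⁻¹ (Φ A v)‖ := by rw [h1]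
        _ ≤ ‖Φ A⁻¹‖ * ‖Φ A v‖ := (Φ A⁻¹).le_opNorm _
        _ ≤ _ := by gcongr; linarith
    rw [hm, one_div, inv_mul_le_iff₀ (by positivity), ← mul_pow]
    exact pow_le_pow_left₀ (norm_nonneg _) h2 2
  have hcontr := exists_contraction_of_neg_gram (Φ A) hm0 hlow hα hα0
  rw [← hΦgram] at hcontr
  -- boundedness of the coefficients
  obtain ⟨MB, hMB⟩ := exists_forall_norm_le_of_finite_range hB Φ
  obtain ⟨Mc, hMc⟩ := exists_forall_norm_le_of_finite_range hc (WithLp.toLp 2 : _ → EuclideanSpace ℝ _)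
  obtain ⟨Md, hMd⟩ := exists_forall_norm_le_of_finite_range hB
    fun C => (WithLp.toLp 2 (C *ᵥ w') : EuclideanSpace ℝ (Fin K))
  have hLB' : Tendsto (fun n => ∑ t ∈ Finset.range n, α t • (Φ (B t) - Φ (-(Aᵀ * A)))) atTop
      (𝓝 (Φ LB)) := by
    refine ((hΦcont.tendsto LB).comp hLB).congr fun n => ?_
    simp only [Function.comp, map_sum, map_smul, map_sub]
  -- For the error `w - w'` the forcing is `c t + B t *ᵥ w'`; its mean vanishes by `hfix`, so no
  -- further centering is needed.
  have hLc' : Tendsto (fun n => ∑ t ∈ Finset.range n,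
      α t • (WithLp.toLp 2 (c t + B t *ᵥ w') : EuclideanSpace ℝ (Fin K))) atTop
      (𝓝 (WithLp.toLp 2 (Lc + LB *ᵥ w'))) := by
    have hmul : Continuous fun C : Matrix (Fin K) (Fin K) ℝ => C *ᵥ w' :=
      Continuous.matrix_mulVec continuous_id continuous_const
    have h1 := hLc.add ((hmul.tendsto LB).comp hLB)
    refine (((PiLp.continuous_toLp 2 _).tendsto _).comp h1).congr fun n => ?_
    simp only [Function.comp]
    rw [Matrix.sum_mulVec, ← Finset.sum_add_distrib, WithLp.toLp_sum]
    refine Finset.sum_congr rfl fun t _ => ?_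
    rw [← WithLp.toLp_smul, Matrix.smul_mulVec, ← smul_add, Matrix.sub_mulVec]
    congr 2
    have h2 : c t - -(Aᵀ *ᵥ b) + (B t *ᵥ w' - -(Aᵀ * A) *ᵥ w') =
        c t + B t *ᵥ w' - (-(Aᵀ * A) *ᵥ w' + -(Aᵀ *ᵥ b)) := by abel
    rw [h2, hfix, sub_zero]
  have hrec : ∀ t, (WithLp.toLp 2 (w (t + 1) - w') : EuclideanSpace ℝ (Fin K)) =
      WithLp.toLp 2 (w t - w') + α t • (Φ (B t) (WithLp.toLp 2 (w t - w')) +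
        WithLp.toLp 2 (c t + B t *ᵥ w')) := by
    intro t
    rw [toEuclideanCLM_toLp, ← WithLp.toLp_add, ← WithLp.toLp_smul, ← WithLp.toLp_add, hw,
      mulVec_sub]
    congr 1
    rw [show B t *ᵥ w t - B t *ᵥ w' + (c t + B t *ᵥ w') = B t *ᵥ w t + c t by abel]
    abel
  have hmain := tendsto_zero_of_linear_recursion hα hα0 hαs hMB
    (fun t => by
      rw [WithLp.toLp_add]
      exact (norm_add_le _ _).trans (add_le_add (hMc t) (hMd t)))
    (by positivity : 0 < m / 2) hcontr hLB' hLc'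
    (e := fun t => WithLp.toLp 2 (w t - w')) hrec
  have h1 := ((PiLp.continuous_ofLp 2 _).tendsto _).comp hmain
  have h2 := h1.add_const w'
  simpa [Function.comp_def] using h2

end OffPolicyTD

/-! ### Convergence of the algorithm -/

open OffPolicyTD

/-- The exceptional null set depends only on the noise series and not on the iterates, so `w₀` may
be any function of `ω`, measurable or not. The first conjunct certifies that the total matrix
inverse in `tdFixedPoint` yields a genuine solution. -/
theorem theorem1 {S Act : Type*} [Fintype S] [DecidableEq S] [Fintype Act] {K : ℕ}
    (M : OffPolicyTD.FiniteMDP S Act) (π μ : OffPolicyTD.Policy S Act) (x : S → Fin K → ℝ)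
    (hirr : (M.transition μ).IsIrreducible)
    (haper : OffPolicyTD.IsAperiodic (M.transition μ))
    (hcov : OffPolicyTD.Covers μ π)
    (hX : (OffPolicyTD.featureMatrix x).rank = K)
    (hA : IsUnit (M.tdMatrix π μ x))
    (Cα ν : ℝ) (hCα : 0 < Cα) (hν : ν ∈ Set.Ioc (2 / 3 : ℝ) 1)
    (f : ℕ → ℕ) (hf_mono : Monotone f)
    (hf_sum : ∀ χ ∈ Set.Ico (0 : ℝ) 1, Summable fun t : ℕ => χ ^ f t)
    (τ Cτ : ℝ) (hτ : τ ∈ Set.Ioo (0 : ℝ) ((3 * ν - 2) / (2 * ν))) (hCτ : 0 < Cτ)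
    (hf_le : ∀ t : ℕ, (f t : ℝ) ≤ Cτ * OffPolicyTD.stepSize Cα ν t ^ (-τ))
    {Ω : Type*} [MeasurableSpace Ω] (ℙ : Measure Ω) [IsProbabilityMeasure ℙ]
    (St : ℕ → Ω → S) (At : ℕ → Ω → Act) (htraj : M.IsTrajectory μ ℙ St At)
    (w₀ : Ω → Fin K → ℝ) :
    M.tdMatrix π μ x *ᵥ M.tdFixedPoint π μ x + M.tdVector π μ x = 0 ∧
      ∀ᵐ ω ∂ℙ, Tendsto
        (fun t : ℕ => M.iterates π μ x (OffPolicyTD.stepSize Cα ν) f (w₀ ω)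
          (fun i => St i ω) (fun i => At i ω) t)
        atTop (𝓝 (M.tdFixedPoint π μ x)) := by
  classical
  have hdet := (Matrix.isUnit_iff_isUnit_det _).1 hA
  have hfix : M.tdMatrix π μ x *ᵥ M.tdFixedPoint π μ x + M.tdVector π μ x = 0 := by
    rw [FiniteMDP.tdFixedPoint, mulVec_neg, mulVec_mulVec, Matrix.mul_nonsing_inv _ hdet,
      one_mulVec, neg_add_cancel]
  refine ⟨hfix, ?_⟩
  let _ : MeasurableSpace (S × Act × S) := ⊤
  have : DiscreteMeasurableSpace (S × Act × S) := ⟨fun _ => trivial⟩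
  have hY := htraj.isMarkovChain
  set Y : ℕ → Ω → S × Act × S := fun t ω => (St t ω, At t ω, St (t + 1) ω) with hYdef
  obtain ⟨χ, hχ, C₀, hC₀, hmix⟩ := M.exists_tripleTransition_mixing μ hirr haper
  have hν0 : 0 < ν := by linarith [hν.1]
  -- With `κ = ν τ`, the bound on `τ` gives even `κ < (3ν - 2) / 2`.
  have hκ : ν * τ < 3 * ν - 2 := by
    have h1 := hτ.2
    rw [lt_div_iff₀ (by positivity)] at h1
    linarith [hν.1]
  have hfκ : ∀ t : ℕ, (f t : ℝ) ≤ Cτ * Cα ^ (-τ) * ((t : ℝ) + 1) ^ (ν * τ) := by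
    intro t
    have ht : (0 : ℝ) < (t : ℝ) + 1 := by positivity
    have h1 := hf_le t
    rw [stepSize_eq, Real.mul_rpow hCα.le (by positivity), ← Real.rpow_mul ht.le, neg_mul_neg,
      ← mul_assoc] at h1
    exact h1
  have hconv := hY.ae_exists_tendsto_sum_product hχ hC₀ hmix hCα hν.2
    (mul_nonneg hν0.le hτ.1.le) hκ (by positivity) hfκ (hf_sum χ ⟨hχ.1.le, hχ.2⟩)
  -- Entry `(i, k)` of the product of the transposed delayed sample with the current one is a sum
  -- over `j` of scalar delayed products, so finitely many null sets suffice.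
  have hmat := ae_all_iff.2 fun i : Fin K => ae_all_iff.2 fun j : Fin K => ae_all_iff.2
    fun k : Fin K => hconv (fun y => M.sampleMatrix π μ x y j i)
      (fun y => M.sampleMatrix π μ x y j k)
  have hvec := ae_all_iff.2 fun i : Fin K => ae_all_iff.2 fun j : Fin K =>
    hconv (fun y => M.sampleMatrix π μ x y j i) (fun y => M.sampleVector π μ x y j)
  simp only [M.stationaryMean_sampleMatrix x hcov, M.stationaryMean_sampleVector x hcov] at hmat hvec
  filter_upwards [hmat, hvec] with ω h₁ h₂
  choose L hL using h₁
  choose l hl using h₂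
  refine tendsto_of_matrix_recursion (stepSize_nonneg hCα ν) (tendsto_stepSize Cα hν0)
    (tendsto_sum_stepSize hCα hν.2)
    (B := fun t => -((M.sampleMatrix π μ x (Y (t + f t) ω))ᵀ * M.sampleMatrix π μ x (Y t ω)))
    (c := fun t => -((M.sampleMatrix π μ x (Y (t + f t) ω))ᵀ *ᵥ M.sampleVector π μ x (Y t ω)))
    ?_ ?_ hA hfix (LB := Matrix.of fun i k => -∑ j, L i j k) (Lc := fun i => -∑ j, l i j)
    ?_ ?_ fun t => ?_
  · refine (Set.finite_range fun y : (S × Act × S) × (S × Act × S) =>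
      -((M.sampleMatrix π μ x y.1)ᵀ * M.sampleMatrix π μ x y.2)).subset ?_
    rintro _ ⟨t, rfl⟩
    exact ⟨(Y (t + f t) ω, Y t ω), rfl⟩
  · refine (Set.finite_range fun y : (S × Act × S) × (S × Act × S) =>
      -((M.sampleMatrix π μ x y.1)ᵀ *ᵥ M.sampleVector π μ x y.2)).subset ?_
    rintro _ ⟨t, rfl⟩
    exact ⟨(Y (t + f t) ω, Y t ω), rfl⟩
  · refine tendsto_pi_nhds.2 fun i => tendsto_pi_nhds.2 fun k => ?_
    refine (tendsto_finsetSum Finset.univ fun j _ => hL i j k).neg.congr fun n => ?_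
    rw [Finset.sum_comm, ← Finset.sum_neg_distrib, Matrix.sum_apply]
    refine Finset.sum_congr rfl fun t _ => ?_
    simp only [Matrix.smul_apply, Matrix.sub_apply, Matrix.neg_apply, Matrix.mul_apply,
      Matrix.transpose_apply, smul_eq_mul, ← Finset.mul_sum, Finset.sum_sub_distrib]
    ring
  · refine tendsto_pi_nhds.2 fun i => ?_
    refine (tendsto_finsetSum Finset.univ fun j _ => hl i j).neg.congr fun n => ?_
    rw [Finset.sum_comm, ← Finset.sum_neg_distrib, Finset.sum_apply]
    refine Finset.sum_congr rfl fun t _ => ?_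
    simp only [Pi.smul_apply, Pi.sub_apply, Pi.neg_apply, Matrix.mulVec, dotProduct,
      Matrix.transpose_apply, smul_eq_mul, ← Finset.mul_sum, Finset.sum_sub_distrib]
    ring
  · rw [FiniteMDP.iterates_succ, neg_mulVec, mulVec_add, neg_add, mulVec_mulVec, neg_mulVec]
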